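/- Let $N\ge 2$, $S=\{1,\dots,N\}$, and for $\varepsilon>0$ let $X^\varepsilon_t$, $t\ge 0$, be a time-homogeneous continuous-time Markov chain on $S$ with transition rates $q_{ij}(\varepsilon)$, $i\ne j$; $\mathrm P_i$ denotes the law of the chain started at $i$. Suppose that the family is asymptotically regular: $q_{ij}(\varepsilon)>0$ for all $\varepsilon>0$ and $i\neq j$, and the limit $\lim_{\varepsilon\downarrow0} q_{ij}(\varepsilon)/q_{kl}(\varepsilon)\in[0,\infty]$ exists for all $i\ne j$, $k\ne l$. Suppose that the skeleton chain, i.e. the discrete-time Markov chain $Z_n$ on $S$ with transition probabilities $$P_{ij}=\lim_{\varepsilon\downarrow 0}\frac{q_{ij}(\varepsilon)}{\sum_{j'\ne i}q_{ij'}(\varepsilon)}\quad (j\neq i),\qquad P_{ii}=0,$$ has exactly one ergodic class and no transient states (i.e. is irreducible). Let $T(i,\varepsilon)=\bigl(\sum_{j\ne i}q_{ij}(\varepsilon)\bigr)^{-1}$, let $t:(0,\infty)\to(0,\infty)$, and write $f\ll g$ if $f(\varepsilon)=o(g(\varepsilon))$ as $\varepsilon\downarrow0$. Suppose that for each $i\in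 S$ either $t(\varepsilon)\ll T(i,\varepsilon)$ or $t(\varepsilon)\gg T(i,\varepsilon)$, and let $E=\{i\in S: t(\varepsilon)\ll T(i,\varepsilon)\}$. Then there are probability measures $\nu(i,\cdot)$, $i\in S$, on $S$ such that $$\lim_{\varepsilon\downarrow0}\mathrm P_i\bigl(X^\varepsilon_{t(\varepsilon)}=j\bigr)=\nu(i,j)\qquad\text{for all } i,j\in S.$$ Moreover, if $E=\emptyset$, then for each $\varepsilon>0$ the chain $X^\varepsilon_t$ has a unique invariant probability measure $\mu(\cdot,\varepsilon)$, and $\nu(i,j)=\lim_{\varepsilon\downarrow 0}\mu(j,\varepsilon)$ for all $i,j\in S$. If $E\neq\emptyset$, then $\nu(i,j)=\mathrm P_i(Z_\tau=j)$ for all $i,j\in S$, where $\tau=\min\{n\ge0: Z_n\in E\}$. -/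

import Mathlib

open Filter Topology MeasureTheory Asymptotics
open scoped NNReal ENNReal

noncomputable section

/-- A time-homogeneous continuous-time Markov chain `X` on the finite state space `S` with
transition rates `q i j` (`i ≠ j`; the diagonal of `q` is never used).  `Pr i` is the law of the
chain started from `i`.  The Markov property is stated for arbitrary finite histories. -/
structure IsMarkovChain {S : Type*} (q : S → S → ℝ) {Ω : Type*} [MeasurableSpace Ω]
    (Pr : S → Measure Ω) (X : ℝ≥0 → Ω → S) : Prop where
  isProbabilityMeasure : ∀ i, IsProbabilityMeasure (Pr i)
  measurableSet : ∀ t j, MeasurableSet {ω | X t ω = j}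
  initial : ∀ i, (Pr i).real {ω | X 0 ω = i} = 1
  markov : ∀ (i : S) (n : ℕ) (u : Fin n → ℝ≥0) (a : Fin n → S) (s h : ℝ≥0), (∀ m, u m ≤ s) →
    ∀ j k, (Pr i).real {ω | (∀ m, X (u m) ω = a m) ∧ X s ω = j ∧ X (s + h) ω = k} =
      (Pr i).real {ω | (∀ m, X (u m) ω = a m) ∧ X s ω = j} * (Pr j).real {ω | X h ω = k}
  rate : ∀ i j, i ≠ j →
    Tendsto (fun h : ℝ≥0 => (Pr i).real {ω | X h ω = j} / (h : ℝ)) (𝓝[>] 0) (𝓝 (q i j))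

/-- A discrete-time Markov chain `Z` on `S` with transition probabilities `P i j`; `Pr i` is the
law of the chain started from `i`. -/
structure IsDiscreteMarkovChain {S : Type*} (P : S → S → ℝ) {Ω : Type*} [MeasurableSpace Ω]
    (Pr : S → Measure Ω) (Z : ℕ → Ω → S) : Prop where
  isProbabilityMeasure : ∀ i, IsProbabilityMeasure (Pr i)
  measurableSet : ∀ n j, MeasurableSet {ω | Z n ω = j}
  initial : ∀ i, (Pr i).real {ω | Z 0 ω = i} = 1
  markov : ∀ (i : S) (n : ℕ) (a : ℕ → S),
    (Pr i).real {ω | ∀ m ≤ n + 1, Z m ω = a m} =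
      (Pr i).real {ω | ∀ m ≤ n, Z m ω = a m} * P (a n) (a (n + 1))

/-- `m` is an invariant probability distribution of the continuous-time chain `X`. -/
def IsInvariantDistribution {S : Type*} [Fintype S] {Ω : Type*} [MeasurableSpace Ω]
    (Pr : S → Measure Ω) (X : ℝ≥0 → Ω → S) (m : S → ℝ) : Prop :=
  m ∈ stdSimplex ℝ S ∧ ∀ (t : ℝ≥0) (j : S), ∑ i, m i * (Pr i).real {ω | X t ω = j} = m j

/-- Asymptotic regularity of a family of transition rates `q ε i j` as `ε ↓ 0`. -/
structure AsymptoticallyRegular {S : Type*} (q : ℝ → S → S → ℝ) : Prop where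
  pos : ∀ ε > 0, ∀ i j, i ≠ j → 0 < q ε i j
  ratio : ∀ i j k l, i ≠ j → k ≠ l →
    ∃ L : ℝ≥0∞, Tendsto (fun ε => ENNReal.ofReal (q ε i j / q ε k l)) (𝓝[>] 0) (𝓝 L)

section Rates

variable {S : Type*} [Fintype S] [DecidableEq S]

/-- The total exit rate of the state `i`. -/
def exitRate (q : ℝ → S → S → ℝ) (i : S) (ε : ℝ) : ℝ := ∑ j ∈ Finset.univ.erase i, q ε i j

/-- The inverse transition rate (mean exit time) `T(i, ε)`. -/
def inverseRate (q : ℝ → S → S → ℝ) (i : S) (ε : ℝ) : ℝ := (exitRate q i ε)⁻¹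

/-- The transition probabilities of the skeleton chain. -/
def skeleton (q : ℝ → S → S → ℝ) (i j : S) : ℝ :=
  if j = i then 0 else limUnder (𝓝[>] (0 : ℝ)) (fun ε => q ε i j / exitRate q i ε)

/-- For asymptotically regular rates the limits defining the skeleton chain exist. -/
theorem AsymptoticallyRegular.tendsto_skeleton {q : ℝ → S → S → ℝ}
    (hq : AsymptoticallyRegular q) {i j : S} (hij : i ≠ j) :
    Tendsto (fun ε => q ε i j / exitRate q i ε) (𝓝[>] 0) (𝓝 (skeleton q i j)) := by
  have hex : ∃ x : ℝ, Tendsto (fun ε => q ε i j / exitRate q i ε) (𝓝[>] 0) (𝓝 x) := by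
    choose! L hL using hq.ratio
    have h1 : Tendsto (fun ε => ∑ k ∈ Finset.univ.erase i, ENNReal.ofReal (q ε i k / q ε i j))
        (𝓝[>] 0) (𝓝 (∑ k ∈ Finset.univ.erase i, L i k i j)) :=
      tendsto_finsetSum _ fun k hk => hL i k i j (Finset.ne_of_mem_erase hk).symm hij
    have hmem : j ∈ Finset.univ.erase i := Finset.mem_erase.2 ⟨hij.symm, Finset.mem_univ _⟩
    have h0 : ∑ k ∈ Finset.univ.erase i, L i k i j ≠ 0 := by
      intro h
      have hj : L i j i j = 0 := by
        have := Finset.sum_eq_zero_iff.1 h j hmem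
        exact this
      have hc : Tendsto (fun ε => ENNReal.ofReal (q ε i j / q ε i j)) (𝓝[>] 0) (𝓝 1) := by
        refine tendsto_const_nhds.congr' ?_
        filter_upwards [self_mem_nhdsWithin] with ε hε
        rw [div_self (hq.pos ε hε i j hij).ne', ENNReal.ofReal_one]
      have := tendsto_nhds_unique hc (hL i j i j hij hij)
      rw [hj] at this
      exact one_ne_zero this
    have h2 := (continuous_inv.tendsto _).comp h1
    have h3 := (ENNReal.tendsto_toReal (ENNReal.inv_ne_top.2 h0)).comp h2
    refine ⟨_, h3.congr' ?_⟩
    filter_upwards [self_mem_nhdsWithin] with ε hε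
    have hp := hq.pos ε hε i j hij
    have hnn : ∀ k ∈ Finset.univ.erase i, 0 ≤ q ε i k / q ε i j := fun k hk =>
      div_nonneg (hq.pos ε hε i k (Finset.ne_of_mem_erase hk).symm).le hp.le
    simp only [Function.comp]
    rw [← ENNReal.ofReal_sum_of_nonneg hnn, ENNReal.toReal_inv,
      ENNReal.toReal_ofReal (Finset.sum_nonneg hnn), ← Finset.sum_div, inv_div]
    rfl
  rw [skeleton, if_neg hij.symm]
  exact tendsto_nhds_limUnder hex

end Rates

section Classification

variable {S : Type*}

/-- `j` is accessible from `i` (in zero or more steps) for the transition probabilities `P`. -/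
def Accessible (P : S → S → ℝ) : S → S → Prop := Relation.ReflTransGen fun a b => 0 < P a b

/-- An ergodic class: a non-empty set of states such that the states accessible from any of its
elements are exactly its elements. -/
def IsErgodicClass (P : S → S → ℝ) (C : Set S) : Prop :=
  C.Nonempty ∧ ∀ i ∈ C, ∀ j, Accessible P i j ↔ j ∈ C

/-- A transient state: one that belongs to no ergodic class. -/
def IsTransientState (P : S → S → ℝ) (i : S) : Prop := ∀ C, IsErgodicClass P C → i ∉ C

end Classification

/-- The event that the discrete-time chain `Z` visits `E` and is at `j` at the first time
`τ = min {n ≥ 0 : Z n ∈ E}`; that is, the event `Z τ = j`. -/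
def hitsAt {S Ω : Type*} (Z : ℕ → Ω → S) (E : Set S) (j : S) : Set Ω :=
  {ω | ∃ n, (∀ m < n, Z m ω ∉ E) ∧ Z n ω ∈ E ∧ Z n ω = j}

/-- The slow states at the time scale `t`: those `i` with `t(ε) ≪ T(i, ε)` as `ε ↓ 0`. -/
def slowStates {S : Type*} [Fintype S] [DecidableEq S] (q : ℝ → S → S → ℝ) (t : ℝ → ℝ≥0) : Set S :=
  {i | (fun ε => (t ε : ℝ)) =o[𝓝[>] 0] inverseRate q i}

end

/-! The proof uses only the transition matrices `p t i j`, which form a semigroup satisfying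
Kolmogorov's backward equation. Its main consequence is the first-jump inequality `firstJump_le`: if
the chain at `i` has time `b` left, a jump made while at least `a` remains passes the problem on to
the next state. Both regimes are obtained by following jumps with this inequality.

If `E` is empty, a fixed constant multiple of the largest mean exit time suffices for a uniformly
positive chance of being in the state with the smallest exit rate, from any start
(`exists_forall_le`): skeleton edges keep probability at least `κ` for small `ε`. Doeblin's
contraction then brings the chain close to its invariant law, since `t` is infinitely many such
blocks. The invariant law itself converges (`exists_tendsto_balanced`): weighted by exit rates and
normalised it is stationary for the jump chain, which tends to the irreducible skeleton, so the
weighted law has a strictly positive limit; dividing out the rates uses only limits of ratios of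
rates.

If `E` is nonempty, a slow state is not left before time `t`, while any fast state is left within an
arbitrarily small fraction of `t`. Induction on the number of jumps (`eventually_sub_le`) bounds `p
t i j` below by the probability that the skeleton first meets `E` at `j` within a given number of
steps. The skeleton hits `E` almost surely, so these bounds exhaust the total mass one and force
convergence. -/

noncomputable section

/-! ### Transition semigroups and the backward equation -/

section Semigroup

variable {S : Type*} [Fintype S]

/-- A standard semigroup of stochastic matrices on a finite set with transition rates `q`. -/
structure IsTransitionSemigroup (q : S → S → ℝ) (p : ℝ≥0 → S → S → ℝ) : Prop where
  nonneg : ∀ t i j, 0 ≤ p t i j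
  sum_eq_one : ∀ t i, ∑ j, p t i j = 1
  zero : ∀ i, p 0 i i = 1
  add : ∀ s h i k, p (s + h) i k = ∑ j, p s i j * p h j k
  rate : ∀ i j, i ≠ j → Tendsto (fun h : ℝ≥0 => p h i j / (h : ℝ)) (𝓝[>] 0) (𝓝 (q i j))

theorem measureReal_eq_sum_fiber {Ω : Type*} [MeasurableSpace Ω] (μ : Measure Ω)
    [IsFiniteMeasure μ] (f : Ω → S) (hf : ∀ j, MeasurableSet {ω | f ω = j}) (A : Set Ω)
    (hA : MeasurableSet A) :
    μ.real A = ∑ j, μ.real {ω | ω ∈ A ∧ f ω = j} := by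
  rw [← measureReal_biUnion_finset]
  · congr 1
    ext ω
    simp
  · intro i _ j _ hij
    refine Set.disjoint_left.2 fun ω h1 h2 => hij ?_
    exact h1.2.symm.trans h2.2
  · exact fun j _ => hA.inter (hf j)

theorem IsMarkovChain.isTransitionSemigroup {q : S → S → ℝ} {Ω : Type*} [MeasurableSpace Ω]
    {Pr : S → Measure Ω} {X : ℝ≥0 → Ω → S} (hX : IsMarkovChain q Pr X) :
    IsTransitionSemigroup q fun t i j => (Pr i).real {ω | X t ω = j} where
  nonneg _ _ _ := measureReal_nonneg
  sum_eq_one t i := by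
    have := hX.isProbabilityMeasure i
    have h := measureReal_eq_sum_fiber (Pr i) (X t) (hX.measurableSet t) Set.univ .univ
    simpa using h.symm
  zero := hX.initial
  add s h i k := by
    have := hX.isProbabilityMeasure i
    rw [measureReal_eq_sum_fiber (Pr i) (X s) (hX.measurableSet s) _ (hX.measurableSet (s + h) k)]
    refine Finset.sum_congr rfl fun j _ => ?_
    have := hX.markov i 0 Fin.elim0 Fin.elim0 s h (fun m => m.elim0) j k
    simp only [IsEmpty.forall_iff, true_and] at this
    rw [← this]
    congr 1
    ext ω
    exact and_comm
  rate := hX.rate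

/-- The total rate of leaving the state `i`. -/
def totalRate [DecidableEq S] (q : S → S → ℝ) (i : S) : ℝ :=
  ∑ j ∈ Finset.univ.erase i, q i j

namespace IsTransitionSemigroup

variable {q : S → S → ℝ} {p : ℝ≥0 → S → S → ℝ}

theorem le_one (hp : IsTransitionSemigroup q p) (t : ℝ≥0) (i j : S) : p t i j ≤ 1 :=
  (hp.sum_eq_one t i) ▸ Finset.single_le_sum (fun k _ => hp.nonneg t i k) (Finset.mem_univ j)

variable [DecidableEq S]

theorem zero_of_ne (hp : IsTransitionSemigroup q p) {i j : S} (hij : i ≠ j) : p 0 i j = 0 := by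
  have h := hp.sum_eq_one 0 i
  rw [← Finset.add_sum_erase _ _ (Finset.mem_univ i), hp.zero i] at h
  exact (Finset.sum_eq_zero_iff_of_nonneg fun k _ => hp.nonneg 0 i k).1 (by linarith) j
    (Finset.mem_erase.2 ⟨hij.symm, Finset.mem_univ j⟩)

/-- Since rows sum to one, the diagonal entry cancels, leaving only the off-diagonal `p h i k`,
whose behaviour for small `h` is given by the rates. -/
theorem add_sub (hp : IsTransitionSemigroup q p) (h s : ℝ≥0) (i j : S) :
    p (h + s) i j - p s i j =
      ∑ k ∈ Finset.univ.erase i, p h i k * (p s k j - p s i j) := by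
  have h1 : p s i j = ∑ k, p h i k * p s i j := by
    rw [← Finset.sum_mul, hp.sum_eq_one, one_mul]
  rw [hp.add, h1, ← Finset.sum_sub_distrib, ← h1,
    ← Finset.add_sum_erase _ _ (Finset.mem_univ i)]
  simp [mul_sub]

theorem abs_add_sub_le (hp : IsTransitionSemigroup q p) (h s : ℝ≥0) (i j : S) :
    |p (h + s) i j - p s i j| ≤ ∑ k ∈ Finset.univ.erase i, p h i k := by
  rw [hp.add_sub]
  refine (Finset.abs_sum_le_sum_abs _ _).trans (Finset.sum_le_sum fun k _ => ?_)
  rw [abs_mul, abs_of_nonneg (hp.nonneg h i k)]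
  refine mul_le_of_le_one_right (hp.nonneg h i k) (abs_le.2 ⟨?_, ?_⟩) <;>
    linarith [hp.nonneg s i j, hp.nonneg s k j, hp.le_one s i j, hp.le_one s k j]

theorem tendsto_nhds_zero (hp : IsTransitionSemigroup q p) {i k : S} (hik : i ≠ k) :
    Tendsto (fun h => p h i k) (𝓝 0) (𝓝 0) := by
  have h1 : Tendsto (fun h => p h i k) (𝓝[>] 0) (𝓝 0) := by
    have h2 : Tendsto (fun h : ℝ≥0 => (h : ℝ)) (𝓝[>] 0) (𝓝 0) :=
      (NNReal.continuous_coe.tendsto 0).mono_left nhdsWithin_le_nhds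
    have h3 := (hp.rate i k hik).mul h2
    rw [mul_zero] at h3
    refine h3.congr' ?_
    filter_upwards [self_mem_nhdsWithin] with h hh
    exact div_mul_cancel₀ _ (NNReal.coe_ne_zero.2 (ne_of_gt hh))
  have h4 : ContinuousWithinAt (fun h => p h i k) (Set.Ioi 0) 0 := by
    rw [ContinuousWithinAt, hp.zero_of_ne hik]; exact h1
  have h5 := continuousWithinAt_insert_self.2 h4
  -- In `ℝ≥0` the right neighbourhood of `0` together with `0` is a full neighbourhood.
  rw [Set.insert_eq, Set.union_comm, Set.Ioi_union_left] at h5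
  have h6 : Set.Ici (0 : ℝ≥0) = Set.univ := Set.eq_univ_of_forall fun x => (zero_le : 0 ≤ x)
  rw [h6, continuousWithinAt_univ, ContinuousAt, hp.zero_of_ne hik] at h5
  exact h5

theorem continuous (hp : IsTransitionSemigroup q p) (i j : S) :
    Continuous fun t : ℝ => p t.toNNReal i j := by
  have key : Tendsto (fun h : ℝ≥0 => ∑ k ∈ Finset.univ.erase i, p h i k) (𝓝 0) (𝓝 0) := by
    have := tendsto_finsetSum (Finset.univ.erase i) (f := fun k (h : ℝ≥0) => p h i k)
      fun k hk => hp.tendsto_nhds_zero (Finset.ne_of_mem_erase hk).symm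
    simpa using this
  have habs : ∀ s t : ℝ≥0, |p t i j - p s i j| ≤
      ∑ k ∈ Finset.univ.erase i, p (nndist t s) i k := by
    intro s t
    rcases le_total s t with h | h
    · have h1 := hp.abs_add_sub_le (t - s) s i j
      rw [tsub_add_cancel_of_le h] at h1
      rwa [NNReal.nndist_eq, tsub_eq_zero_of_le h, max_eq_left zero_le]
    · have h1 := hp.abs_add_sub_le (s - t) t i j
      rw [tsub_add_cancel_of_le h] at h1
      rwa [NNReal.nndist_eq, tsub_eq_zero_of_le h, max_eq_right zero_le, abs_sub_comm]
  have hc : Continuous fun t => p t i j := by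
    refine continuous_iff_continuousAt.2 fun s => ?_
    rw [ContinuousAt, tendsto_iff_dist_tendsto_zero]
    refine squeeze_zero (fun _ => dist_nonneg) (fun t => habs s t) (key.comp ?_)
    have : Continuous fun t : ℝ≥0 => nndist t s := by fun_prop
    simpa using this.tendsto s
  exact hc.comp continuous_real_toNNReal

/-- Kolmogorov's backward equation: divide `add_sub` by the short initial time. With continuity, the
right derivative is all that the monotonicity arguments below need. -/
theorem hasDerivWithinAt (hp : IsTransitionSemigroup q p) (i j : S) {s : ℝ} (hs : 0 ≤ s) :
    HasDerivWithinAt (fun t : ℝ => p t.toNNReal i j)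
      (∑ k ∈ Finset.univ.erase i, q i k * (p s.toNNReal k j - p s.toNNReal i j))
      (Set.Ici s) s := by
  rw [← hasDerivWithinAt_Ioi_iff_Ici, hasDerivWithinAt_iff_tendsto_slope' (by simp)]
  have hmap : Tendsto (fun x : ℝ => (x - s).toNNReal) (𝓝[>] s) (𝓝[>] 0) := by
    refine tendsto_nhdsWithin_iff.2 ⟨?_, ?_⟩
    · have : Continuous fun x : ℝ => (x - s).toNNReal := by fun_prop
      have := this.tendsto s
      simp only [sub_self, Real.toNNReal_zero] at this
      exact this.mono_left nhdsWithin_le_nhds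
    · filter_upwards [self_mem_nhdsWithin] with x hx
      exact Real.toNNReal_pos.2 (sub_pos.2 hx)
  have h1 := tendsto_finsetSum (Finset.univ.erase i) fun k hk =>
    ((hp.rate i k (Finset.ne_of_mem_erase hk).symm).comp hmap).mul_const
      (p s.toNNReal k j - p s.toNNReal i j)
  refine h1.congr' ?_
  filter_upwards [self_mem_nhdsWithin] with x hx
  have hx' : s < x := hx
  have h2 : x.toNNReal = (x - s).toNNReal + s.toNNReal := by
    rw [← Real.toNNReal_add (sub_nonneg.2 hx'.le) hs, sub_add_cancel]
  rw [slope_def_field, h2, hp.add_sub, Finset.sum_div]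
  refine Finset.sum_congr rfl fun k _ => ?_
  simp only [Function.comp, Real.coe_toNNReal _ (sub_nonneg.2 hx'.le)]
  ring

/-- A lower bound for the transition probabilities obtained by conditioning on the first jump. -/
theorem firstJump_le (hp : IsTransitionSemigroup q p) {i j : S} (hi : 0 < totalRate q i)
    (hq : ∀ k, i ≠ k → 0 ≤ q i k) {a b : ℝ≥0} (hab : a ≤ b) {c : S → ℝ}
    (hc : ∀ u, a ≤ u → u ≤ b → ∀ k, i ≠ k → c k ≤ p u k j) {m : ℝ}
    (hm : m = ∑ k ∈ Finset.univ.erase i, q i k / totalRate q i * c k) :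
    m + Real.exp (-(totalRate q i * (b - a))) * (p a i j - m) ≤ p b i j := by
  set r := totalRate q i with hr
  have hexp : ∀ x : ℝ, HasDerivAt (fun u : ℝ => Real.exp (r * u)) (Real.exp (r * x) * r) x :=
    fun x => by simpa using ((hasDerivAt_id x).const_mul r).exp
  have hmr : r * m = ∑ k ∈ Finset.univ.erase i, q i k * c k := by
    rw [hm, Finset.mul_sum]
    refine Finset.sum_congr rfl fun k _ => ?_
    field_simp
  -- With `r` the exit rate, `exp (r u) * (p u i j - m)` has nonnegative right derivative on `[a,
  -- b)`: there the backward equation bounds the derivative of `p u i j` below by `r * (m - p u i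
  -- j)`.
  have key := image_le_of_deriv_right_le_deriv_boundary
    (f := fun _ : ℝ => Real.exp (r * a) * (p (a : ℝ).toNNReal i j - m)) (f' := fun _ => 0)
    (a := (a : ℝ)) (b := (b : ℝ)) continuousOn_const
    (fun x _ => hasDerivWithinAt_const _ _ _)
    (B := fun u : ℝ => Real.exp (r * u) * (p u.toNNReal i j - m))
    (B' := fun u => Real.exp (r * u) * r * (p u.toNNReal i j - m) + Real.exp (r * u) *
      (∑ k ∈ Finset.univ.erase i, q i k * (p u.toNNReal k j - p u.toNNReal i j)))
    le_rfl
    (((by fun_prop : Continuous fun u : ℝ => Real.exp (r * u)).mul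
      ((hp.continuous i j).sub continuous_const)).continuousOn)
    (fun x hx => ((hexp x).hasDerivWithinAt.mul
      ((hp.hasDerivWithinAt i j (a.2.trans hx.1)).sub_const m)))
    (fun x hx => by
      have h1 : ∑ k ∈ Finset.univ.erase i, q i k * (p x.toNNReal k j - p x.toNNReal i j) =
          ∑ k ∈ Finset.univ.erase i, q i k * p x.toNNReal k j - r * p x.toNNReal i j := by
        simp only [mul_sub, Finset.sum_sub_distrib, ← Finset.sum_mul]
        rfl
      have h2 : r * m ≤ ∑ k ∈ Finset.univ.erase i, q i k * p x.toNNReal k j := by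
        rw [hmr]
        refine Finset.sum_le_sum fun k hk => ?_
        have hik := (Finset.ne_of_mem_erase hk).symm
        exact mul_le_mul_of_nonneg_left (hc _ (NNReal.le_toNNReal_of_coe_le hx.1)
          (Real.toNNReal_le_iff_le_coe.2 hx.2.le) k hik) (hq k hik)
      rw [h1, mul_assoc, ← mul_add]
      exact mul_nonneg (Real.exp_pos _).le (by linarith))
    (Set.right_mem_Icc.2 (NNReal.coe_le_coe.2 hab))
  simp only [Real.toNNReal_coe] at key
  have h3 : Real.exp (-(r * (b - a))) = Real.exp (r * a) / Real.exp (r * b) := by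
    rw [← Real.exp_sub]; congr 1; ring
  have h4 : Real.exp (r * a) / Real.exp (r * b) * (p a i j - m) ≤ p b i j - m := by
    rw [div_mul_eq_mul_div, div_le_iff₀ (Real.exp_pos _)]
    linarith
  rw [h3]; linarith

theorem exp_neg_le (hp : IsTransitionSemigroup q p) {i : S} (hi : 0 < totalRate q i)
    (hq : ∀ k, i ≠ k → 0 ≤ q i k) (s : ℝ≥0) :
    Real.exp (-(totalRate q i * s)) ≤ p s i i := by
  have h := hp.firstJump_le (j := i) hi hq (a := 0) (b := s) zero_le (c := fun _ => 0)
    (fun u _ _ k _ => hp.nonneg u k i) rfl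
  simpa [hp.zero] using h

end IsTransitionSemigroup

end Semigroup

/-! ### Invariant distributions and uniform ergodicity -/

section Stationary

variable {S : Type*} [Fintype S] [DecidableEq S]

/-- The global balance equations for the measure `v`, with flow rates `R i j` (`i ≠ j`) and
exit rates `d`. -/
def IsBalanced (R : S → S → ℝ) (d v : S → ℝ) : Prop :=
  ∀ j, ∑ i ∈ Finset.univ.erase j, v i * R i j = v j * d j

/-- Along an edge out of a charged state the inflow is positive, hence so is the outflow, and the
next state is charged too. -/
theorem IsBalanced.pos {R : S → S → ℝ} {d v : S → ℝ} (hv : IsBalanced R d v)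
    (hR : ∀ i j, i ≠ j → 0 ≤ R i j) (h0 : ∀ i, 0 ≤ v i) {i j : S}
    (hij : Relation.ReflTransGen (fun a b => a ≠ b ∧ 0 < R a b) i j) (hi : 0 < v i) :
    0 < v j := by
  induction hij with
  | refl => exact hi
  | @tail b c _ hbc ih =>
    have h1 : 0 < ∑ a ∈ Finset.univ.erase c, v a * R a c :=
      Finset.sum_pos' (fun a ha => mul_nonneg (h0 a) (hR a c (Finset.ne_of_mem_erase ha)))
        ⟨b, Finset.mem_erase.2 ⟨hbc.1, Finset.mem_univ b⟩, mul_pos ih hbc.2⟩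
    rw [hv c] at h1
    exact (h0 c).lt_of_ne fun h => by simp [← h] at h1

theorem IsBalanced.pos_of_mem_stdSimplex {R : S → S → ℝ} {d v : S → ℝ} (hv : IsBalanced R d v)
    (hR : ∀ i j, i ≠ j → 0 ≤ R i j)
    (hirr : ∀ i j, Relation.ReflTransGen (fun a b => a ≠ b ∧ 0 < R a b) i j)
    (h0 : v ∈ stdSimplex ℝ S) (j : S) : 0 < v j := by
  obtain ⟨i, -, hi⟩ : ∃ i ∈ Finset.univ, 0 < v i :=
    (Finset.sum_pos_iff_of_nonneg fun i _ => h0.1 i).1 (h0.2.symm ▸ one_pos)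
  exact hv.pos hR h0.1 (hirr i j) hi

/-- With `c` the smallest ratio `v i / w i`, the balanced vector `v - c w` is nonnegative and
vanishes somewhere, so by propagation of positivity it vanishes everywhere; normalisation gives `c =
1`. -/
theorem IsBalanced.unique {R : S → S → ℝ} {d v w : S → ℝ} (hv : IsBalanced R d v)
    (hw : IsBalanced R d w) (hR : ∀ i j, i ≠ j → 0 ≤ R i j)
    (hirr : ∀ i j, Relation.ReflTransGen (fun a b => a ≠ b ∧ 0 < R a b) i j)
    (hv0 : v ∈ stdSimplex ℝ S) (hw0 : w ∈ stdSimplex ℝ S) : v = w := by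
  have hwp := hw.pos_of_mem_stdSimplex hR hirr hw0
  have hne : Nonempty S := by
    by_contra h
    rw [not_nonempty_iff] at h
    simpa using hv0.2
  obtain ⟨i₀, hi₀⟩ := Finite.exists_min fun i => v i / w i
  set c := v i₀ / w i₀ with hc
  have hu : IsBalanced R d fun i => v i - c * w i := fun j => by
    have h1 := hv j
    have h2 := hw j
    simp only [sub_mul, Finset.sum_sub_distrib, mul_assoc, ← Finset.mul_sum, h1, h2]
  have hu0 : ∀ i, 0 ≤ v i - c * w i := fun i =>
    sub_nonneg.2 ((le_div_iff₀ (hwp i)).1 (hi₀ i))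
  have hz : v i₀ - c * w i₀ = 0 := by rw [hc, div_mul_cancel₀ _ (hwp i₀).ne', sub_self]
  have hall : ∀ i, v i = c * w i := fun i => by
    by_contra h
    have := hu.pos hR hu0 (hirr i i₀) ((hu0 i).lt_of_ne fun h' => h (by linarith))
    exact this.ne' hz
  have hc1 : c = 1 := by
    have h1 := hv0.2
    simp only [hall, ← Finset.mul_sum, hw0.2, mul_one] at h1
    exact h1
  funext i
  rw [hall i, hc1, one_mul]

/-- Summation by parts: the generator acting on functions becomes the balance defect of `m`. -/
theorem sum_mul_generator (q : S → S → ℝ) (m f : S → ℝ) :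
    ∑ i, m i * ∑ k ∈ Finset.univ.erase i, q i k * (f k - f i) =
      ∑ k, f k * (∑ i ∈ Finset.univ.erase k, m i * q i k - m k * totalRate q k) := by
  have h : ∀ g : S → S → ℝ, ∑ i, ∑ k ∈ Finset.univ.erase i, g i k =
      ∑ k, ∑ i ∈ Finset.univ.erase k, g i k := fun g =>
    Finset.sum_comm' fun x y => by simp [eq_comm]
  simp only [mul_sub, Finset.sum_sub_distrib, Finset.mul_sum]
  rw [h]
  congr 1
  · exact Finset.sum_congr rfl fun k _ => Finset.sum_congr rfl fun i _ => by ring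
  · refine Finset.sum_congr rfl fun k _ => ?_
    rw [totalRate, Finset.mul_sum, Finset.mul_sum]
    exact Finset.sum_congr rfl fun i _ => by ring

namespace IsTransitionSemigroup

variable {q : S → S → ℝ} {p : ℝ≥0 → S → S → ℝ}

theorem zero_apply (hp : IsTransitionSemigroup q p) (i j : S) :
    p 0 i j = if i = j then 1 else 0 := by
  split_ifs with h
  · rw [h, hp.zero]
  · exact hp.zero_of_ne h

theorem hasDerivWithinAt_sum (hp : IsTransitionSemigroup q p) (m : S → ℝ) (j : S) {s : ℝ}
    (hs : 0 ≤ s) :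
    HasDerivWithinAt (fun t : ℝ => ∑ i, m i * p t.toNNReal i j)
      (∑ k, p s.toNNReal k j *
        (∑ i ∈ Finset.univ.erase k, m i * q i k - m k * totalRate q k)) (Set.Ici s) s := by
  rw [← sum_mul_generator]
  exact HasDerivWithinAt.fun_sum fun i _ => (hp.hasDerivWithinAt i j hs).const_mul (m i)

/-- The time derivative of `m` evolved by `p` is the balance defect evolved by `p`: no defect means
constancy, and at time `0`, where `p` is the identity, the derivative is the defect itself. -/
theorem isBalanced_iff (hp : IsTransitionSemigroup q p) (m : S → ℝ) :
    IsBalanced q (totalRate q) m ↔ ∀ (t : ℝ≥0) (j : S), ∑ i, m i * p t i j = m j := by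
  constructor
  · intro hm t j
    have h := constant_of_has_deriv_right_zero
      (f := fun t : ℝ => ∑ i, m i * p t.toNNReal i j) (a := 0) (b := t)
      (continuous_finsetSum _ fun i _ => (hp.continuous i j).const_mul (m i)).continuousOn
      (fun x hx => by
        have h1 := hp.hasDerivWithinAt_sum m j hx.1
        simpa only [hm _, sub_self, mul_zero, Finset.sum_const_zero] using h1)
      t (Set.right_mem_Icc.2 t.2)
    simpa [hp.zero_apply] using h
  · intro hm j
    have h1 := hp.hasDerivWithinAt_sum m j le_rfl
    simp only [hm] at h1
    have h2 := (uniqueDiffOn_Ici (0 : ℝ) 0 Set.self_mem_Ici).eq_deriv _ h1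
      (hasDerivWithinAt_const (0 : ℝ) (Set.Ici 0) (m j))
    simp only [Real.toNNReal_zero, hp.zero_apply, ite_mul, one_mul, zero_mul,
      Finset.sum_ite_eq', Finset.mem_univ, if_true] at h2
    linarith

/-- The generator kills constants, so it has a left null vector, possibly of mixed signs; its
absolute value is invariant as well and can be normalised. -/
theorem exists_isBalanced (hp : IsTransitionSemigroup q p) [Nonempty S] :
    ∃ m ∈ stdSimplex ℝ S, IsBalanced q (totalRate q) m := by
  let G : Matrix S S ℝ := fun i j => if i = j then -totalRate q i else q i j
  have hdet : G.det = 0 := by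
    refine Matrix.exists_mulVec_eq_zero_iff.1 ⟨fun _ => 1, ?_, ?_⟩
    · exact fun h => one_ne_zero (congrFun h (Classical.arbitrary S))
    · funext i
      simp only [Matrix.mulVec, dotProduct, mul_one, Pi.zero_apply]
      rw [← Finset.add_sum_erase _ _ (Finset.mem_univ i)]
      rw [Finset.sum_congr rfl (g := q i) fun j hj => if_neg (Finset.ne_of_mem_erase hj).symm]
      simp [G, totalRate]
  obtain ⟨v, hv0, hv⟩ := Matrix.exists_vecMul_eq_zero_iff.2 hdet
  have hvb : IsBalanced q (totalRate q) v := fun j => by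
    have h := congrFun hv j
    simp only [Matrix.vecMul, dotProduct, Pi.zero_apply] at h
    rw [← Finset.add_sum_erase _ _ (Finset.mem_univ j),
      Finset.sum_congr rfl (g := fun i => v i * q i j)
        fun i hi => by rw [show G i j = q i j from if_neg (Finset.ne_of_mem_erase hi)]] at h
    simp only [G, if_true] at h
    linarith
  have hvinv := (hp.isBalanced_iff v).1 hvb
  have hsum : 0 < ∑ i, |v i| := by
    obtain ⟨i, hi⟩ := Function.ne_iff.1 hv0
    exact Finset.sum_pos' (fun i _ => abs_nonneg _) ⟨i, Finset.mem_univ i, abs_pos.2 hi⟩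
  -- The triangle inequality gives `≥` in each coordinate, and both sides have the same total mass.
  have habs : ∀ (t : ℝ≥0) (j : S), ∑ i, |v i| * p t i j = |v j| := by
    intro t
    have hle : ∀ j ∈ Finset.univ, |v j| ≤ ∑ i, |v i| * p t i j := fun j _ => by
      rw [← hvinv t j]
      refine (Finset.abs_sum_le_sum_abs _ _).trans (Finset.sum_le_sum fun i _ => ?_)
      rw [abs_mul, abs_of_nonneg (hp.nonneg t i j)]
    have heq : ∑ j, |v j| = ∑ j, ∑ i, |v i| * p t i j := by
      rw [Finset.sum_comm]
      simp [← Finset.mul_sum, hp.sum_eq_one]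
    exact fun j => ((Finset.sum_eq_sum_iff_of_le hle).1 heq j (Finset.mem_univ j)).symm
  refine ⟨fun i => |v i| / ∑ k, |v k|, ⟨fun i => div_nonneg (abs_nonneg _) hsum.le, ?_⟩,
    (hp.isBalanced_iff _).2 fun t j => ?_⟩
  · rw [← Finset.sum_div, div_self hsum.ne']
  · simp only [div_mul_eq_mul_div, ← Finset.sum_div, habs]

/-- If the state `m` is reachable by jumps of probability at least `κ` and `m` has the smallest
exit rate, then `m` is occupied with a probability bounded below in terms of `κ` only. -/
theorem exists_forall_le {r : S → S → Prop} {κ : ℝ} (hκ : 0 < κ) {i m : S}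
    (hr : Relation.ReflTransGen r i m) :
    ∃ (n : ℕ) (c : ℝ), 0 < c ∧ ∀ (q : S → S → ℝ) (p : ℝ≥0 → S → S → ℝ),
      IsTransitionSemigroup q p → (∀ i, 0 < totalRate q i) → (∀ i j, i ≠ j → 0 ≤ q i j) →
      (∀ i j, r i j → i ≠ j ∧ κ * totalRate q i ≤ q i j) →
      (∀ i, totalRate q m ≤ totalRate q i) →
      ∀ s : ℝ≥0, n ≤ totalRate q m * s → c * Real.exp (-(totalRate q m * s)) ≤ p s i m := by
  induction hr using Relation.ReflTransGen.head_induction_on with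
  | refl =>
    refine ⟨0, 1, one_pos, fun q p hp hpos hq _ _ s _ => ?_⟩
    rw [one_mul]
    exact hp.exp_neg_le (hpos m) (hq m) s
  | @head i k hik _ ih =>
    obtain ⟨n, c, hc, h⟩ := ih
    have he : 0 < 1 - Real.exp (-1) := by
      rw [sub_pos, Real.exp_lt_one_iff]; norm_num
    -- Time is measured in units of `1 / totalRate q m`. One extra unit lets the first jump occur
    -- with probability at least `1 - exp (-1)`, because every exit rate is at least that of `m`;
    -- the jump follows the chosen edge with probability at least `κ`.
    refine ⟨n + 1, (1 - Real.exp (-1)) * (κ * c), by positivity,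
      fun q p hp hpos hq hκr hmin s hs => ?_⟩
    set l := totalRate q m with hl
    have hlpos : 0 < l := hpos m
    obtain ⟨hne, hκk⟩ := hκr i k hik
    push_cast at hs
    set a : ℝ≥0 := (n / l).toNNReal with ha
    have hacoe : (a : ℝ) = n / l := Real.coe_toNNReal _ (by positivity)
    have has : a ≤ s := by
      rw [← NNReal.coe_le_coe, hacoe, div_le_iff₀ hlpos]
      linarith
    set e := c * Real.exp (-(l * s)) with hedef
    have hepos : 0 < e := by positivity
    have hlow := hp.firstJump_le (i := i) (j := m) (hpos i) (hq i) has
      (c := fun k' => if k' = k then e else 0)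
      (fun u hau hus k' _ => by
        split_ifs with hk'
        · subst hk'
          refine le_trans ?_ (h q p hp hpos hq hκr hmin u ?_)
          · refine mul_le_mul_of_nonneg_left (Real.exp_le_exp.2 ?_) hc.le
            have : (u : ℝ) ≤ s := hus
            have := mul_le_mul_of_nonneg_left this hlpos.le
            linarith
          · have : (a : ℝ) ≤ u := hau
            rw [hacoe, div_le_iff₀ hlpos] at this
            linarith
        · exact hp.nonneg u k' m)
      rfl
    have hm : ∑ k' ∈ Finset.univ.erase i, q i k' / totalRate q i * (if k' = k then e else 0)
        = q i k / totalRate q i * e := by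
      simp [hne.symm]
    rw [hm] at hlow
    have hκ' : κ ≤ q i k / totalRate q i := (le_div_iff₀ (hpos i)).2 hκk
    have hexp : Real.exp (-(totalRate q i * (s - a))) ≤ Real.exp (-1) := by
      rw [Real.exp_le_exp, neg_le_neg_iff]
      have h1 : 1 ≤ l * (s - a) := by
        rw [mul_sub, hacoe, mul_div_cancel₀ _ hlpos.ne']
        linarith
      have h2 : (0 : ℝ) ≤ s - a := sub_nonneg.2 has
      exact h1.trans (mul_le_mul_of_nonneg_right (hmin i) h2)
    have hge : κ * e ≤ q i k / totalRate q i * e := mul_le_mul_of_nonneg_right hκ' hepos.le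
    have h0 := mul_nonneg (Real.exp_pos (-(totalRate q i * (s - a)))).le (hp.nonneg a i m)
    calc (1 - Real.exp (-1)) * (κ * c) * Real.exp (-(l * s))
        = (1 - Real.exp (-1)) * (κ * e) := by rw [hedef]; ring
      _ ≤ (1 - Real.exp (-(totalRate q i * (s - a)))) * (q i k / totalRate q i * e) := by
        refine mul_le_mul (by linarith) hge (by positivity) (by linarith)
      _ ≤ p s i m := by linarith

/-- Doeblin's contraction: the spread of `p (n * s + r) · j` is at most `(1 - c) ^ n`. -/
theorem exists_forall_mem_Icc (hp : IsTransitionSemigroup q p) {c : ℝ}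
    {s : ℝ≥0} {m : S} (hs : ∀ i, c ≤ p s i m) (r : ℝ≥0) (j : S) (n : ℕ) :
    ∃ a : ℝ, ∀ i, p (n * s + r) i j ∈ Set.Icc a (a + (1 - c) ^ n) := by
  induction n with
  | zero => exact ⟨0, fun i => by simpa using ⟨hp.nonneg r i j, hp.le_one r i j⟩⟩
  | succ n ih =>
    obtain ⟨a, ha⟩ := ih
    set f : S → ℝ := fun k => p (n * s + r) k j with hf
    -- The mass `c` sent to `m` from every start contributes the same amount to all rows; the
    -- remainder is nonnegative with row sums `1 - c`.
    have key : ∀ i, p ((n + 1 : ℕ) * s + r) i j =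
        c * f m + ∑ k, (p s i k - if k = m then c else 0) * f k := fun i => by
      have : ((n + 1 : ℕ) : ℝ≥0) * s + r = s + (n * s + r) := by push_cast; ring
      rw [this, hp.add]
      simp [sub_mul, Finset.sum_sub_distrib, hf]
    have hw : ∀ i k, 0 ≤ p s i k - if k = m then c else 0 := fun i k => by
      split_ifs with h
      · rw [h]; linarith [hs i]
      · simpa using hp.nonneg s i k
    have hw1 : ∀ i, ∑ k, (p s i k - if k = m then c else 0) = 1 - c := fun i => by
      simp [Finset.sum_sub_distrib, hp.sum_eq_one]
    refine ⟨c * f m + (1 - c) * a, fun i => ?_⟩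
    rw [key i]
    constructor
    · rw [← hw1 i, Finset.sum_mul]
      gcongr with k _
      · exact hw i k
      · exact (ha k).1
    · have : ∑ k, (p s i k - if k = m then c else 0) * f k ≤ (1 - c) * (a + (1 - c) ^ n) := by
        rw [← hw1 i, Finset.sum_mul, hw1 i]
        gcongr with k _
        · exact hw i k
        · exact (ha k).2
      rw [pow_succ]
      linarith

/-- By invariance `v j` is a `v`-average of the entries `p t k j`, so it lies in the same short
interval as they do. -/
theorem abs_sub_le_pow (hp : IsTransitionSemigroup q p) {c : ℝ}
    {s : ℝ≥0} {m : S} (hs : ∀ i, c ≤ p s i m) {v : S → ℝ} (hv : v ∈ stdSimplex ℝ S)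
    (hvb : IsBalanced q (totalRate q) v) {n : ℕ} {t : ℝ≥0} (ht : n * s ≤ t) (i j : S) :
    |p t i j - v j| ≤ (1 - c) ^ n := by
  obtain ⟨a, ha⟩ := hp.exists_forall_mem_Icc hs (t - n * s) j n
  rw [add_tsub_cancel_of_le ht] at ha
  have hvj := (hp.isBalanced_iff v).1 hvb t j
  have h1 : a ≤ v j := by
    rw [← hvj, ← one_mul a, ← hv.2, Finset.sum_mul]
    exact Finset.sum_le_sum fun k _ => mul_le_mul_of_nonneg_left (ha k).1 (hv.1 k)
  have h2 : v j ≤ a + (1 - c) ^ n := by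
    calc v j = ∑ k, v k * p t k j := hvj.symm
      _ ≤ ∑ k, v k * (a + (1 - c) ^ n) :=
        Finset.sum_le_sum fun k _ => mul_le_mul_of_nonneg_left (ha k).2 (hv.1 k)
      _ = a + (1 - c) ^ n := by rw [← Finset.sum_mul, hv.2, one_mul]
  rw [abs_le]
  constructor <;> linarith [(ha i).1, (ha i).2]

end IsTransitionSemigroup

/-- A family of semigroups whose jump chains are uniformly irreducible converges to equilibrium
exponentially fast on the time scale of the slowest exit. -/
theorem exists_forall_abs_sub_le_pow [Nonempty S] {r : S → S → Prop} {κ : ℝ} (hκ : 0 < κ)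
    (hr : ∀ i j, Relation.ReflTransGen r i j) :
    ∃ (n : ℕ) (c : ℝ), 0 < c ∧ c ≤ 1 ∧ ∀ (q : S → S → ℝ) (p : ℝ≥0 → S → S → ℝ),
      IsTransitionSemigroup q p → (∀ i, 0 < totalRate q i) → (∀ i j, i ≠ j → 0 ≤ q i j) →
      (∀ i j, r i j → i ≠ j ∧ κ * totalRate q i ≤ q i j) →
      ∀ v ∈ stdSimplex ℝ S, IsBalanced q (totalRate q) v →
      ∀ (k : ℕ) (t : ℝ≥0), (∀ i, k * n ≤ totalRate q i * t) →
      ∀ i j, |p t i j - v j| ≤ (1 - c) ^ k := by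
  choose n c hc h using fun x : S × S =>
    IsTransitionSemigroup.exists_forall_le hκ (hr x.1 x.2)
  -- The slowest state depends on `q`, so the constants must serve all pairs of states at once.
  obtain ⟨x₀, hx₀⟩ := Finite.exists_max n
  obtain ⟨x₁, hx₁⟩ := Finite.exists_min c
  refine ⟨n x₀, min (c x₁ * Real.exp (-n x₀)) 1,
    lt_min (mul_pos (hc _) (Real.exp_pos _)) one_pos, min_le_right _ _,
    fun q p hp hpos hq hκr v hv hvb k t hkt => ?_⟩
  obtain ⟨m, hm⟩ := Finite.exists_min (totalRate q)
  have hs0 : 0 ≤ n x₀ / totalRate q m := div_nonneg (Nat.cast_nonneg _) (hpos m).le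
  have hs1 : totalRate q m * ((n x₀ / totalRate q m).toNNReal : ℝ≥0) = n x₀ := by
    rw [Real.coe_toNNReal _ hs0, mul_div_cancel₀ _ (hpos m).ne']
  refine hp.abs_sub_le_pow (s := (n x₀ / totalRate q m).toNNReal) (m := m)
    (fun i => (min_le_left _ _).trans ?_) hv hvb ?_
  · have := h (i, m) q p hp hpos hq hκr hm (n x₀ / totalRate q m).toNNReal
      (by rw [hs1]; exact_mod_cast hx₀ (i, m))
    rw [hs1] at this
    exact (mul_le_mul_of_nonneg_right (hx₁ (i, m)) (Real.exp_pos _).le).trans this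
  · rw [← NNReal.coe_le_coe]
    push_cast
    rw [Real.coe_toNNReal _ hs0, mul_div_assoc', div_le_iff₀ (hpos m), mul_comm (t : ℝ)]
    exact hkt m

end Stationary

theorem accessible_of_existsUnique_ergodicClass {S : Type*} {P : S → S → ℝ} (h : ∃! C : Set S, IsErgodicClass P C)
    (ht : ∀ i, ¬ IsTransientState P i) (i j : S) : Accessible P i j := by
  obtain ⟨C, hC, huniq⟩ := h
  have hmem : ∀ k, k ∈ C := fun k => by
    have := ht k
    simp only [IsTransientState, not_forall, not_not] at this
    obtain ⟨D, hD, hk⟩ := this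
    exact huniq D hD ▸ hk
  exact (hC.2 i (hmem i) j).2 (hmem j)

/-! ### Asymptotics of invariant laws, and equilibration -/

section Regular

variable {S : Type*} [Fintype S] [DecidableEq S]

namespace AsymptoticallyRegular

variable {q : ℝ → S → S → ℝ}

theorem exitRate_pos [Nontrivial S] (hq : AsymptoticallyRegular q) {ε : ℝ} (hε : 0 < ε) (i : S) :
    0 < exitRate q i ε := by
  obtain ⟨j, hj⟩ := exists_ne i
  exact Finset.sum_pos (fun k hk => hq.pos ε hε i k (Finset.ne_of_mem_erase hk).symm)
    ⟨j, Finset.mem_erase.2 ⟨hj, Finset.mem_univ j⟩⟩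

theorem skeleton_nonneg [Nontrivial S] (hq : AsymptoticallyRegular q) (i j : S) :
    0 ≤ skeleton q i j := by
  rcases eq_or_ne i j with rfl | hij
  · simp [skeleton]
  · refine ge_of_tendsto (hq.tendsto_skeleton hij) ?_
    filter_upwards [self_mem_nhdsWithin] with ε hε
    exact div_nonneg (hq.pos ε hε i j hij).le (hq.exitRate_pos hε i).le

theorem sum_erase_skeleton [Nontrivial S] (hq : AsymptoticallyRegular q) (i : S) :
    ∑ j ∈ Finset.univ.erase i, skeleton q i j = 1 := by
  refine tendsto_nhds_unique (tendsto_finsetSum (Finset.univ.erase i) fun j hj =>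
    hq.tendsto_skeleton (Finset.ne_of_mem_erase hj).symm) (tendsto_const_nhds.congr' ?_)
  filter_upwards [self_mem_nhdsWithin] with ε hε
  rw [← Finset.sum_div]
  exact (div_self (hq.exitRate_pos hε i).ne').symm

theorem sum_skeleton [Nontrivial S] (hq : AsymptoticallyRegular q) (i : S) :
    ∑ j, skeleton q i j = 1 := by
  rw [← Finset.add_sum_erase _ _ (Finset.mem_univ i), hq.sum_erase_skeleton]
  simp [skeleton]

theorem ne_of_skeleton_pos {i j : S} (h : 0 < skeleton q i j) : i ≠ j := by
  rintro rfl
  simp [skeleton] at h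

/-- Finite sums and inversion are continuous on `[0, ∞]`, so the limit is assembled from the ratios
of single rates without case distinctions. -/
theorem exists_tendsto_exitRate_div [Nontrivial S] (hq : AsymptoticallyRegular q) (i k : S) :
    ∃ L : ℝ≥0∞, Tendsto (fun ε => ENNReal.ofReal (exitRate q i ε / exitRate q k ε))
      (𝓝[>] 0) (𝓝 L) := by
  choose! L hL using hq.ratio
  have h1 : ∀ l ∈ Finset.univ.erase i, Tendsto
      (fun ε => ENNReal.ofReal (q ε i l / exitRate q k ε)) (𝓝[>] 0)
      (𝓝 (∑ l' ∈ Finset.univ.erase k, L k l' i l)⁻¹) := by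
    intro l hl
    have hil := (Finset.ne_of_mem_erase hl).symm
    have h2 := (continuous_inv.tendsto _).comp (tendsto_finsetSum (Finset.univ.erase k)
      fun l' hl' => hL k l' i l (Finset.ne_of_mem_erase hl').symm hil)
    refine h2.congr' ?_
    filter_upwards [self_mem_nhdsWithin] with ε hε
    have hp := hq.pos ε hε i l hil
    have hnn : ∀ l' ∈ Finset.univ.erase k, 0 ≤ q ε k l' / q ε i l := fun l' hl' =>
      div_nonneg (hq.pos ε hε k l' (Finset.ne_of_mem_erase hl').symm).le hp.le
    simp only [Function.comp]
    rw [← ENNReal.ofReal_sum_of_nonneg hnn, ← Finset.sum_div]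
    change (ENNReal.ofReal (exitRate q k ε / q ε i l))⁻¹ = _
    rw [← ENNReal.ofReal_inv_of_pos (div_pos (hq.exitRate_pos hε k) hp), inv_div]
  refine ⟨_, (tendsto_finsetSum _ h1).congr' ?_⟩
  filter_upwards [self_mem_nhdsWithin] with ε hε
  rw [← ENNReal.ofReal_sum_of_nonneg fun l hl => div_nonneg
    (hq.pos ε hε i l (Finset.ne_of_mem_erase hl).symm).le (hq.exitRate_pos hε k).le,
    ← Finset.sum_div]
  rfl

/-- The stationary distributions of the jump chains converge. -/
theorem exists_tendsto_jump [Nontrivial S] (hq : AsymptoticallyRegular q)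
    (hirr : ∀ i j, Accessible (skeleton q) i j) {w : ℝ → S → ℝ}
    (hw : ∀ ε > 0, w ε ∈ stdSimplex ℝ S)
    (hwb : ∀ ε > 0, IsBalanced (fun i j => q ε i j / exitRate q i ε) (fun _ => 1) (w ε)) :
    ∃ x : S → ℝ, (∀ i, 0 < x i) ∧ Tendsto w (𝓝[>] 0) (𝓝 x) := by
  have hirr' : ∀ i j,
      Relation.ReflTransGen (fun a b => a ≠ b ∧ 0 < skeleton q a b) i j := fun i j =>
    Relation.ReflTransGen.mono (fun a b h => ⟨ne_of_skeleton_pos h, h⟩) i j (hirr i j)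
  have hlim : ∀ (U : Ultrafilter ℝ), (U : Filter ℝ) ≤ 𝓝[>] 0 → ∀ x, Tendsto w U (𝓝 x) →
      x ∈ stdSimplex ℝ S ∧ IsBalanced (skeleton q) (fun _ => 1) x := by
    intro U hU x hx
    refine ⟨(isClosed_stdSimplex ℝ S).mem_of_tendsto hx (hU ?_), fun j => ?_⟩
    · filter_upwards [self_mem_nhdsWithin] with ε hε using hw ε hε
    · have hxi := fun i => (tendsto_pi_nhds.1 hx) i
      refine tendsto_nhds_unique (tendsto_finsetSum (Finset.univ.erase j) fun i hi =>
        (hxi i).mul ((hq.tendsto_skeleton (Finset.ne_of_mem_erase hi)).mono_left hU))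
        (((hxi j).mul_const 1).congr' (hU ?_))
      filter_upwards [self_mem_nhdsWithin] with ε hε
      exact (hwb ε hε j).symm
  have hev : ∀ᶠ ε in 𝓝[>] (0 : ℝ), w ε ∈ stdSimplex ℝ S := by
    filter_upwards [self_mem_nhdsWithin] with ε hε using hw ε hε
  obtain ⟨x, -, hxc⟩ := (isCompact_stdSimplex ℝ S).exists_mapClusterPt_of_frequently
    hev.frequently
  have hlim' : ∀ y, MapClusterPt y (𝓝[>] 0) w →
      y ∈ stdSimplex ℝ S ∧ IsBalanced (skeleton q) (fun _ => 1) y := fun y hy => by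
    obtain ⟨U, hU, hyU⟩ := mapClusterPt_iff_ultrafilter.1 hy
    exact hlim U hU y hyU
  obtain ⟨hx1, hx2⟩ := hlim' x hxc
  refine ⟨x, hx2.pos_of_mem_stdSimplex (fun i j _ => hq.skeleton_nonneg i j) hirr' hx1,
    -- Every cluster point is stationary for the irreducible skeleton, so there is only one.
    (isCompact_stdSimplex ℝ S).tendsto_nhds_of_unique_mapClusterPt hev fun y hy hyc => ?_⟩
  obtain ⟨hy1, hy2⟩ := hlim' y hyc
  exact hy2.unique hx2 (fun i j _ => hq.skeleton_nonneg i j) hirr' hy1 hx1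

/-- The weights `w i`, proportional to `v i` times the exit rate, are stationary for the jump chain
and have a positive limit. The sum over `k` of `v k / v j`, that is, of `w k / w j` times the ratio
of the exit rates of `j` and `k`, equals `1 / v j` and converges in `[0, ∞]`; positive limits of `w`
exclude the form `0 * ∞`. -/
theorem exists_tendsto_balanced [Nontrivial S] (hq : AsymptoticallyRegular q)
    (hirr : ∀ i j, Accessible (skeleton q) i j) {v : ℝ → S → ℝ}
    (hv : ∀ ε > 0, v ε ∈ stdSimplex ℝ S)
    (hvb : ∀ ε > 0, IsBalanced (q ε) (totalRate (q ε)) (v ε)) (j : S) :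
    ∃ L : ℝ, Tendsto (fun ε => v ε j) (𝓝[>] 0) (𝓝 L) := by
  set Z : ℝ → ℝ := fun ε => ∑ i, v ε i * exitRate q i ε with hZ
  set w : ℝ → S → ℝ := fun ε i => v ε i * exitRate q i ε / Z ε with hwdef
  have hZpos : ∀ ε > 0, 0 < Z ε := fun ε hε => by
    obtain ⟨i, -, hi⟩ : ∃ i ∈ Finset.univ, 0 < v ε i :=
      (Finset.sum_pos_iff_of_nonneg fun i _ => (hv ε hε).1 i).1 ((hv ε hε).2.symm ▸ one_pos)
    exact Finset.sum_pos' (fun i _ => mul_nonneg ((hv ε hε).1 i) (hq.exitRate_pos hε i).le)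
      ⟨i, Finset.mem_univ i, mul_pos hi (hq.exitRate_pos hε i)⟩
  obtain ⟨x, hxpos, hx⟩ := hq.exists_tendsto_jump hirr (w := w)
    (fun ε hε => ⟨fun i => div_nonneg (mul_nonneg ((hv ε hε).1 i) (hq.exitRate_pos hε i).le)
      (hZpos ε hε).le, by
        rw [hwdef]
        simp only [← Finset.sum_div]
        exact div_self (hZpos ε hε).ne'⟩)
    (fun ε hε k => by
      have h1 : ∀ i, w ε i * (q ε i k / exitRate q i ε) = v ε i * q ε i k / Z ε := fun i => by
        have := (hq.exitRate_pos hε i).ne'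
        rw [hwdef]
        field_simp
      simp only [h1, ← Finset.sum_div, hvb ε hε k, mul_one]
      rfl)
  have hxi := fun i => (tendsto_pi_nhds.1 hx) i
  choose L hL using hq.exists_tendsto_exitRate_div
  have h1 : Tendsto (fun ε => ∑ k, ENNReal.ofReal (w ε k / w ε j) *
      ENNReal.ofReal (exitRate q j ε / exitRate q k ε)) (𝓝[>] 0)
      (𝓝 (∑ k, ENNReal.ofReal (x k / x j) * L j k)) :=
    tendsto_finsetSum _ fun k _ => ENNReal.Tendsto.mul
      (ENNReal.tendsto_ofReal ((hxi k).div (hxi j) (hxpos j).ne'))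
      (Or.inl (ENNReal.ofReal_pos.2 (div_pos (hxpos k) (hxpos j))).ne') (hL j k)
      (Or.inr ENNReal.ofReal_ne_top)
  have hwj : ∀ᶠ ε in 𝓝[>] (0 : ℝ), 0 < w ε j := (hxi j).eventually_const_lt (hxpos j)
  have h2 : ∀ᶠ ε in 𝓝[>] (0 : ℝ), ∑ k, ENNReal.ofReal (w ε k / w ε j) *
      ENNReal.ofReal (exitRate q j ε / exitRate q k ε) = (ENNReal.ofReal (v ε j))⁻¹ ∧
      0 < v ε j := by
    filter_upwards [hwj, self_mem_nhdsWithin] with ε hwε hε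
    have hvj : 0 < v ε j := by
      refine ((hv ε hε).1 j).lt_of_ne fun h => ?_
      simp [hwdef, ← h] at hwε
    refine ⟨?_, hvj⟩
    have hnn : ∀ k, 0 ≤ w ε k / w ε j := fun k => div_nonneg (div_nonneg (mul_nonneg
      ((hv ε hε).1 k) (hq.exitRate_pos hε k).le) (hZpos ε hε).le) hwε.le
    have hterm : ∀ k, ENNReal.ofReal (w ε k / w ε j) *
        ENNReal.ofReal (exitRate q j ε / exitRate q k ε) = ENNReal.ofReal (v ε k / v ε j) := by
      intro k
      rw [← ENNReal.ofReal_mul (hnn k)]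
      congr 1
      have := (hq.exitRate_pos hε k).ne'
      have := (hq.exitRate_pos hε j).ne'
      have := (hZpos ε hε).ne'
      rw [hwdef]
      field_simp
    simp only [hterm]
    rw [← ENNReal.ofReal_sum_of_nonneg fun k _ => div_nonneg ((hv ε hε).1 k) hvj.le,
      ← Finset.sum_div, (hv ε hε).2, one_div, ENNReal.ofReal_inv_of_pos hvj]
  have h3 : Tendsto (fun ε => ENNReal.ofReal (v ε j)) (𝓝[>] 0)
      (𝓝 (∑ k, ENNReal.ofReal (x k / x j) * L j k)⁻¹) := by
    refine ((continuous_inv.tendsto _).comp h1).congr' ?_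
    filter_upwards [h2] with ε hε
    simp only [Function.comp, hε.1, inv_inv]
  have h4 : (∑ k, ENNReal.ofReal (x k / x j) * L j k)⁻¹ ≠ ⊤ := by
    refine ne_top_of_le_ne_top ENNReal.one_ne_top (le_of_tendsto h3 ?_)
    filter_upwards [self_mem_nhdsWithin] with ε hε
    rw [ENNReal.ofReal_le_one, ← (hv ε hε).2]
    exact Finset.single_le_sum (fun k _ => (hv ε hε).1 k) (Finset.mem_univ j)
  refine ⟨_, ((ENNReal.tendsto_toReal h4).comp h3).congr' ?_⟩
  filter_upwards [h2] with ε hε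
  exact ENNReal.toReal_ofReal hε.2.le

/-- If the time scale exceeds all exit times, the chain equilibrates. -/
theorem tendsto_sub_balanced [Nontrivial S] (hq : AsymptoticallyRegular q)
    (hirr : ∀ i j, Accessible (skeleton q) i j) {p : ℝ → ℝ≥0 → S → S → ℝ}
    (hp : ∀ ε > 0, IsTransitionSemigroup (q ε) (p ε)) {t : ℝ → ℝ≥0}
    (ht : ∀ i, Tendsto (fun ε => exitRate q i ε * t ε) (𝓝[>] 0) atTop) {v : ℝ → S → ℝ}
    (hv : ∀ ε > 0, v ε ∈ stdSimplex ℝ S)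
    (hvb : ∀ ε > 0, IsBalanced (q ε) (totalRate (q ε)) (v ε)) (i j : S) :
    Tendsto (fun ε => p ε (t ε) i j - v ε j) (𝓝[>] 0) (𝓝 0) := by
  -- The inequality is strict so that the actual jump probabilities exceed `κ` for all small `ε`.
  obtain ⟨κ, hκ, hκs⟩ : ∃ κ > 0, ∀ a b, 0 < skeleton q a b → κ < skeleton q a b := by
    have h : ∀ x : S × S, ∃ y > 0, 0 < skeleton q x.1 x.2 → y < skeleton q x.1 x.2 := fun x => by
      by_cases hx : 0 < skeleton q x.1 x.2
      · exact ⟨_, half_pos hx, fun _ => half_lt_self hx⟩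
      · exact ⟨1, one_pos, fun h => absurd h hx⟩
    choose y hy hy' using h
    obtain ⟨x₀, hx₀⟩ := Finite.exists_min y
    exact ⟨y x₀, hy x₀, fun a b hab => (hx₀ (a, b)).trans_lt (hy' (a, b) hab)⟩
  obtain ⟨n, c, hc, hc1, h⟩ := exists_forall_abs_sub_le_pow hκ hirr
  have hκe : ∀ᶠ ε in 𝓝[>] (0 : ℝ), ∀ a b, 0 < skeleton q a b →
      a ≠ b ∧ κ * totalRate (q ε) a ≤ q ε a b := by
    refine eventually_all.2 fun a => eventually_all.2 fun b => ?_
    by_cases hab : 0 < skeleton q a b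
    · have hne := ne_of_skeleton_pos hab
      filter_upwards [(hq.tendsto_skeleton hne).eventually_const_lt (hκs a b hab),
        self_mem_nhdsWithin] with ε hε hε0 _
      exact ⟨hne, ((lt_div_iff₀ (hq.exitRate_pos hε0 a)).1 hε).le⟩
    · exact Eventually.of_forall fun _ h => absurd h hab
  rw [Metric.tendsto_nhds]
  intro δ hδ
  obtain ⟨k, hk⟩ := exists_pow_lt_of_lt_one hδ (by linarith : 1 - c < 1)
  filter_upwards [hκe, self_mem_nhdsWithin,
    eventually_all.2 fun a => (ht a).eventually_ge_atTop (k * n : ℝ)] with ε h1 hε h2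
  rw [Real.dist_eq, sub_zero]
  exact (h (q ε) (p ε) (hp ε hε) (hq.exitRate_pos hε) (fun a b hab => (hq.pos ε hε a b hab).le) h1 (v ε) (hv ε hε)
    (hvb ε hε) k (t ε) h2 i j).trans_lt hk

end AsymptoticallyRegular

end Regular

/-! ### First hitting of a set by a discrete chain -/

section Hitting

variable {S : Type*} {P : S → S → ℝ} {E : Set S}

/-- The transition matrix `P` killed on `E`: the rows of the states in `E` are set to zero. -/
def killed (P : S → S → ℝ) (E : Set S) : Matrix S S ℝ :=
  fun i j => Eᶜ.indicator (fun k => P k j) i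

theorem killed_of_mem {i : S} (hi : i ∈ E) (j : S) : killed P E i j = 0 := by
  simp [killed, hi]

theorem killed_of_notMem {i : S} (hi : i ∉ E) (j : S) : killed P E i j = P i j := by
  simp [killed, hi]

variable [Fintype S]

namespace IsDiscreteMarkovChain

variable {Ω : Type*} [MeasurableSpace Ω] {Pr : S → Measure Ω} {Z : ℕ → Ω → S}

theorem measurableSet_avoid (hZ : IsDiscreteMarkovChain P Pr Z) (E : Set S) (j : S) (n : ℕ) :
    MeasurableSet {ω | (∀ m < n, Z m ω ∉ E) ∧ Z n ω = j} := by
  have h : {ω | (∀ m < n, Z m ω ∉ E) ∧ Z n ω = j} =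
      (⋂ m, ⋂ (_ : m < n), ⋃ x ∈ Eᶜ, {ω | Z m ω = x}) ∩ {ω | Z n ω = j} := by
    ext ω
    simp
  rw [h]
  exact (MeasurableSet.iInter fun m => MeasurableSet.iInter fun _ =>
    MeasurableSet.biUnion (Set.to_countable _) fun x _ => hZ.measurableSet m x).inter
    (hZ.measurableSet n j)

/-- The Markov property is given for single paths only, so the event is split over all histories
before time `n`; those meeting `E` contribute zero on both sides. -/
theorem measureReal_avoid_succ (hZ : IsDiscreteMarkovChain P Pr Z) (E : Set S) (i j k : S)
    (n : ℕ) :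
    (Pr i).real {ω | ((∀ m < n, Z m ω ∉ E) ∧ Z n ω = k) ∧ Z (n + 1) ω = j} =
      (Pr i).real {ω | (∀ m < n, Z m ω ∉ E) ∧ Z n ω = k} * P k j := by
  have := hZ.isProbabilityMeasure i
  have hA := hZ.measurableSet_avoid E k n
  have hf : ∀ a : Fin n → S, MeasurableSet {ω | (fun m : Fin n => Z m ω) = a} := fun a => by
    have h : {ω | (fun m : Fin n => Z m ω) = a} = ⋂ m : Fin n, {ω | Z m ω = a m} := by
      ext ω
      simp [funext_iff]
    rw [h]
    exact MeasurableSet.iInter fun m => hZ.measurableSet m (a m)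
  rw [measureReal_eq_sum_fiber (Pr i) (fun ω (m : Fin n) => Z m ω) hf
      {ω | ((∀ m < n, Z m ω ∉ E) ∧ Z n ω = k) ∧ Z (n + 1) ω = j}
      (hA.inter (hZ.measurableSet (n + 1) j)),
    measureReal_eq_sum_fiber (Pr i) (fun ω (m : Fin n) => Z m ω) hf _ hA, Finset.sum_mul]
  refine Finset.sum_congr rfl fun a _ => ?_
  by_cases ha : ∀ m, a m ∉ E
  · set b : ℕ → S := fun m => if h : m < n then a ⟨m, h⟩ else if m = n then k else j with hb
    have hb1 : ∀ m : Fin n, b m = a m := fun m => by simp [hb]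
    have hb2 : b n = k := by simp [hb]
    have hb3 : b (n + 1) = j := by simp [hb]
    have h := hZ.markov i n b
    rw [hb2, hb3] at h
    have key : ∀ ω, (((∀ m < n, Z m ω ∉ E) ∧ Z n ω = k) ∧ (fun m : Fin n => Z m ω) = a) ↔
        ∀ m ≤ n, Z m ω = b m := fun ω => by
      constructor
      · rintro ⟨⟨-, h1⟩, h2⟩ m hm
        rcases hm.lt_or_eq with hm | rfl
        · exact (congrFun h2 ⟨m, hm⟩).trans (hb1 ⟨m, hm⟩).symm
        · rw [h1, hb2]
      · intro h1
        have h2 : ∀ m : Fin n, Z m ω = a m := fun m => (h1 m m.2.le).trans (hb1 m)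
        exact ⟨⟨fun m hm => h2 ⟨m, hm⟩ ▸ ha ⟨m, hm⟩, hb2 ▸ h1 n le_rfl⟩, funext h2⟩
    convert h using 2
    · congr 1
      ext ω
      constructor
      · rintro ⟨⟨h1, h2⟩, h3⟩ m hm
        rcases Nat.le_succ_iff.1 hm with hm | rfl
        · exact (key ω).1 ⟨h1, h3⟩ m hm
        · rw [h2, hb3]
      · intro h1
        have h2 := (key ω).2 fun m hm => h1 m (hm.trans n.le_succ)
        exact ⟨⟨h2.1, hb3 ▸ h1 (n + 1) le_rfl⟩, h2.2⟩
    · congr 1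
      ext ω
      exact key ω
  · have h0 : ∀ ω, (∀ m < n, Z m ω ∉ E) → (fun m : Fin n => Z m ω) ≠ a := fun ω h1 h2 =>
      ha fun m => h2 ▸ h1 m m.2
    have e1 : {ω | ω ∈ {ω | ((∀ m < n, Z m ω ∉ E) ∧ Z n ω = k) ∧ Z (n + 1) ω = j} ∧
        (fun m : Fin n => Z m ω) = a} = ∅ :=
      Set.eq_empty_of_forall_notMem fun ω h => h0 ω h.1.1.1 h.2
    have e2 : {ω | ω ∈ {ω | (∀ m < n, Z m ω ∉ E) ∧ Z n ω = k} ∧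
        (fun m : Fin n => Z m ω) = a} = ∅ :=
      Set.eq_empty_of_forall_notMem fun ω h => h0 ω h.1.1 h.2
    rw [e1, e2]
    simp

end IsDiscreteMarkovChain

variable [DecidableEq S]

/-- The law of the position at the first visit to `E` of the chain with transition matrix `P`. -/
def hittingLaw (P : S → S → ℝ) (E : Set S) (i j : S) : ℝ :=
  E.indicator (fun k => ∑' n, (killed P E ^ n) i k) j

theorem killed_pow_nonneg (hP : ∀ i j, 0 ≤ P i j) (n : ℕ) (i j : S) :
    0 ≤ (killed P E ^ n) i j := by
  induction n generalizing j with
  | zero => rw [pow_zero, Matrix.one_apply]; split_ifs <;> norm_num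
  | succ n ih =>
    rw [pow_succ, Matrix.mul_apply]
    exact Finset.sum_nonneg fun k _ =>
      mul_nonneg (ih k) (Set.indicator_nonneg (fun k _ => hP k j) k)

open Classical in
-- Conservation of mass: each killed step removes exactly the mass sitting in `E`, and this is the
-- mass recorded as having hit.
theorem sum_hit_add_sum_killed (hP1 : ∀ i, ∑ j, P i j = 1) (n : ℕ) (i : S) :
    ∑ j with j ∈ E, ∑ m ∈ Finset.range n, (killed P E ^ m) i j + ∑ j, (killed P E ^ n) i j = 1 := by
  induction n with
  | zero => simp [Matrix.one_apply]
  | succ n ih =>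
    have h1 : ∑ j, (killed P E ^ (n + 1)) i j = ∑ j with j ∉ E, (killed P E ^ n) i j := by
      simp only [pow_succ, Matrix.mul_apply]
      rw [Finset.sum_comm, Finset.sum_filter]
      refine Finset.sum_congr rfl fun k _ => ?_
      rw [← Finset.mul_sum]
      by_cases hk : k ∈ E
      · simp [hk, killed_of_mem hk]
      · simp [hk, killed_of_notMem hk, hP1]
    rw [h1]
    simp only [Finset.sum_range_succ, Finset.sum_add_distrib]
    rw [add_assoc, Finset.sum_filter_add_sum_filter_not]
    exact ih

/-- Maximum principle: the limiting survival probability `L` is harmonic off `E` and zero on `E`.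
Its maximum propagates along accessible states and so reaches `E`. -/
theorem tendsto_sum_killed_pow (hP : ∀ i j, 0 ≤ P i j) (hP1 : ∀ i, ∑ j, P i j = 1)
    (hirr : ∀ i j, Accessible P i j) (hE : E.Nonempty) (i : S) :
    Tendsto (fun n => ∑ j, (killed P E ^ n) i j) atTop (𝓝 0) := by
  classical
  set r : ℕ → S → ℝ := fun n i => ∑ j, (killed P E ^ n) i j with hr
  have hr0 : ∀ n i, 0 ≤ r n i := fun n i =>
    Finset.sum_nonneg fun j _ => killed_pow_nonneg hP n i j
  have hanti : ∀ i, Antitone fun n => r n i := fun i => antitone_nat_of_succ_le fun n => by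
    have h1 := sum_hit_add_sum_killed (E := E) hP1 n i
    have h2 := sum_hit_add_sum_killed (E := E) hP1 (n + 1) i
    simp only [Finset.sum_range_succ, Finset.sum_add_distrib] at h2
    have h3 : 0 ≤ ∑ j with j ∈ E, (killed P E ^ n) i j :=
      Finset.sum_nonneg fun j _ => killed_pow_nonneg hP n i j
    simp only [hr]
    linarith
  have hlim : ∀ i, ∃ L, Tendsto (fun n => r n i) atTop (𝓝 L) := fun i =>
    ⟨_, tendsto_atTop_ciInf (hanti i) ⟨0, by rintro _ ⟨n, rfl⟩; exact hr0 n i⟩⟩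
  choose L hL using hlim
  have hLeq : ∀ i, L i = ∑ k, killed P E i k * L k := fun i => by
    refine tendsto_nhds_unique ((hL i).comp (tendsto_add_atTop_nat 1)) ?_
    refine (tendsto_finsetSum Finset.univ fun k _ => (hL k).const_mul (killed P E i k)).congr
      fun n => ?_
    simp only [Function.comp, hr, pow_succ', Matrix.mul_apply, Finset.mul_sum]
    exact Finset.sum_comm
  have hLE : ∀ i ∈ E, L i = 0 := fun i hi => by
    rw [hLeq]
    simp [killed_of_mem hi]
  have hL0 : ∀ i, 0 ≤ L i := fun i => ge_of_tendsto' (hL i) fun n => hr0 n i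
  obtain ⟨e, he⟩ := hE
  have : Nonempty S := ⟨e⟩
  obtain ⟨i₀, hi₀⟩ := Finite.exists_max L
  have hmax : ∀ k, Accessible P i₀ k → L k = L i₀ ∨ L i₀ = 0 := by
    intro k hk
    induction hk with
    | refl => exact Or.inl rfl
    | @tail b c _ hbc ih =>
      rcases ih with ih | ih
      · by_cases hb : b ∈ E
        · exact Or.inr (ih ▸ hLE b hb)
        · have h1 : ∑ k, P b k * L k = ∑ k, P b k * L i₀ := by
            rw [← Finset.sum_mul, hP1, one_mul, ← ih, hLeq b]
            simp only [killed_of_notMem hb]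
          have h2 := (Finset.sum_eq_sum_iff_of_le fun k _ =>
            mul_le_mul_of_nonneg_left (hi₀ k) (hP b k)).1 h1 c (Finset.mem_univ c)
          exact Or.inl (mul_left_cancel₀ hbc.ne' h2)
      · exact Or.inr ih
  have hz : L i₀ = 0 := by
    rcases hmax e (hirr i₀ e) with h | h
    · rw [← h, hLE e he]
    · exact h
  have hLi : L i = 0 := le_antisymm (hz ▸ hi₀ i) (hL0 i)
  exact hLi ▸ hL i

theorem hasSum_hittingLaw (hP : ∀ i j, 0 ≤ P i j) (hP1 : ∀ i, ∑ j, P i j = 1) (i : S) {j : S}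
    (hj : j ∈ E) : HasSum (fun n => (killed P E ^ n) i j) (hittingLaw P E i j) := by
  classical
  rw [hittingLaw, Set.indicator_of_mem hj]
  refine (summable_of_sum_range_le (c := 1) (fun n => killed_pow_nonneg hP n i j)
    fun n => ?_).hasSum
  rw [← sum_hit_add_sum_killed (E := E) hP1 n i]
  have h1 := Finset.single_le_sum (f := fun k => ∑ m ∈ Finset.range n, (killed P E ^ m) i k)
    (s := {k | k ∈ E}) (fun k _ => Finset.sum_nonneg fun m _ => killed_pow_nonneg hP m i k)
    (Finset.mem_filter.2 ⟨Finset.mem_univ j, hj⟩)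
  have h2 : 0 ≤ ∑ k, (killed P E ^ n) i k :=
    Finset.sum_nonneg fun k _ => killed_pow_nonneg hP n i k
  linarith

theorem hittingLaw_nonneg (hP : ∀ i j, 0 ≤ P i j) (i j : S) : 0 ≤ hittingLaw P E i j :=
  Set.indicator_nonneg (fun k _ => tsum_nonneg fun n => killed_pow_nonneg hP n i k) j

theorem sum_hittingLaw (hP : ∀ i j, 0 ≤ P i j) (hP1 : ∀ i, ∑ j, P i j = 1)
    (hirr : ∀ i j, Accessible P i j) (hE : E.Nonempty) (i : S) :
    ∑ j, hittingLaw P E i j = 1 := by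
  classical
  have h1 : ∑ j, hittingLaw P E i j = ∑ j with j ∈ E, hittingLaw P E i j := by
    refine (Finset.sum_subset (Finset.subset_univ _) fun j _ hj => ?_).symm
    simp only [Finset.mem_filter, Finset.mem_univ, true_and] at hj
    exact Set.indicator_of_notMem hj _
  have h2 := (tendsto_finsetSum ({j | j ∈ E} : Finset S) fun j hj =>
    (hasSum_hittingLaw hP hP1 i (Finset.mem_filter.1 hj).2).tendsto_sum_nat).add
    (tendsto_sum_killed_pow hP hP1 hirr hE i)
  rw [h1]
  rw [add_zero] at h2
  refine tendsto_nhds_unique h2 (tendsto_const_nhds.congr fun n => ?_)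
  exact (sum_hit_add_sum_killed hP1 n i).symm

namespace IsDiscreteMarkovChain

variable {Ω : Type*} [MeasurableSpace Ω] {Pr : S → Measure Ω} {Z : ℕ → Ω → S}

theorem measureReal_avoid (hZ : IsDiscreteMarkovChain P Pr Z) (E : Set S) (i j : S) (n : ℕ) :
    (Pr i).real {ω | (∀ m < n, Z m ω ∉ E) ∧ Z n ω = j} = (killed P E ^ n) i j := by
  have := hZ.isProbabilityMeasure i
  induction n generalizing j with
  | zero =>
    simp only [not_lt_zero, IsEmpty.forall_iff, implies_true, true_and, pow_zero,
      Matrix.one_apply]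
    split_ifs with hij
    · rw [← hij, hZ.initial]
    · have h2 : (Pr i).real {ω | Z 0 ω = i}ᶜ = 0 := by
        rw [probReal_compl_eq_one_sub (hZ.measurableSet 0 i), hZ.initial, sub_self]
      refine measureReal_mono_null (fun ω hω => ?_) h2
      exact fun h => hij (h.symm.trans hω)
  | succ n ih =>
    rw [measureReal_eq_sum_fiber (Pr i) (Z n) (hZ.measurableSet n) _
      (hZ.measurableSet_avoid E j (n + 1)), pow_succ, Matrix.mul_apply]
    refine Finset.sum_congr rfl fun k _ => ?_
    by_cases hk : k ∈ E
    · rw [killed_of_mem hk, mul_zero]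
      convert measureReal_empty
      refine Set.eq_empty_of_forall_notMem fun ω h => ?_
      exact h.1.1 n n.lt_succ_self (h.2 ▸ hk)
    · rw [killed_of_notMem hk, ← ih, ← hZ.measureReal_avoid_succ]
      congr 1
      ext ω
      constructor
      · rintro ⟨⟨h1, h2⟩, h3⟩
        exact ⟨⟨fun m hm => h1 m (hm.trans n.lt_succ_self), h3⟩, h2⟩
      · rintro ⟨⟨h1, h2⟩, h3⟩
        refine ⟨⟨fun m hm => ?_, h3⟩, h2⟩
        rcases Nat.lt_succ_iff_lt_or_eq.1 hm with hm | rfl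
        · exact h1 m hm
        · rw [h2]; exact hk

theorem measureReal_hitsAt (hZ : IsDiscreteMarkovChain P Pr Z) (hP : ∀ i j, 0 ≤ P i j)
    (hP1 : ∀ i, ∑ j, P i j = 1) (E : Set S) (i j : S) :
    (Pr i).real (hitsAt Z E j) = hittingLaw P E i j := by
  have := hZ.isProbabilityMeasure i
  by_cases hj : j ∈ E
  · have hU : hitsAt Z E j = ⋃ n, {ω | (∀ m < n, Z m ω ∉ E) ∧ Z n ω = j} := by
      ext ω
      simp only [hitsAt, Set.mem_ofPred_eq, Set.mem_iUnion]
      refine exists_congr fun n => ⟨fun h => ⟨h.1, h.2.2⟩, fun h => ⟨h.1, ?_, h.2⟩⟩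
      rw [h.2]; exact hj
    have hdisj : Pairwise (Function.onFun Disjoint
        fun n => {ω | (∀ m < n, Z m ω ∉ E) ∧ Z n ω = j}) := by
      have : ∀ a b, a < b → Disjoint {ω | (∀ m < a, Z m ω ∉ E) ∧ Z a ω = j}
          {ω | (∀ m < b, Z m ω ∉ E) ∧ Z b ω = j} := fun a b hab =>
        Set.disjoint_left.2 fun ω h1 h2 => h2.1 a hab (h1.2 ▸ hj)
      intro a b hab
      rcases hab.lt_or_gt with h | h
      · exact this a b h
      · exact (this b a h).symm
    rw [hU, measureReal_def, measure_iUnion hdisj fun n => hZ.measurableSet_avoid E j n,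
      ENNReal.tsum_toReal_eq fun n => measure_ne_top _ _]
    simp only [← measureReal_def, hZ.measureReal_avoid]
    exact (hasSum_hittingLaw hP hP1 i hj).tsum_eq
  · have : hitsAt Z E j = ∅ := Set.eq_empty_of_forall_notMem fun ω ⟨n, _, h1, h2⟩ => hj (h2 ▸ h1)
    rw [this, measureReal_empty, hittingLaw, Set.indicator_of_notMem hj]

end IsDiscreteMarkovChain

end Hitting

/-! ### Stopping at the first slow state -/

section SlowStates

/-- Asymptotic lower bounds suffice: as both total masses are one, an excess in one coordinate would
need a deficit in the others. -/
theorem tendsto_of_eventually_sub_le {S : Type*} [Fintype S] {α : Type*} {l : Filter α} {x : α → S → ℝ} {y : S → ℝ}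
    (hx : ∀ᶠ a in l, ∑ j, x a j = 1) (hy : ∑ j, y j = 1)
    (h : ∀ j, ∀ η > 0, ∀ᶠ a in l, y j - η ≤ x a j) (j : S) :
    Tendsto (fun a => x a j) l (𝓝 (y j)) := by
  rw [Metric.tendsto_nhds]
  intro δ hδ
  have hc : (0 : ℝ) < Fintype.card S + 2 := by positivity
  filter_upwards [hx, eventually_all.2 fun k => h k (δ / (Fintype.card S + 2)) (by positivity)]
    with a ha hk
  set η := δ / (Fintype.card S + 2) with hη
  have hηδ : (Fintype.card S + 2) * η = δ := mul_div_cancel₀ _ hc.ne'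
  have hηpos : 0 < η := by positivity
  have hcard : (0 : ℝ) ≤ Fintype.card S := by positivity
  have h1 : ∑ k, (x a k - y k + η) = Fintype.card S * η := by
    simp [Finset.sum_add_distrib, Finset.sum_sub_distrib, ha, hy]
  have h2 := Finset.single_le_sum (f := fun k => x a k - y k + η)
    (fun k _ => by linarith [hk k]) (Finset.mem_univ j)
  rw [h1] at h2
  have h3 := hk j
  rw [Real.dist_eq, abs_lt]
  constructor <;> nlinarith

variable {S : Type*} [Fintype S] [DecidableEq S]

namespace AsymptoticallyRegular

variable {q : ℝ → S → S → ℝ}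

/-- The bound is uniform over `s` in `[δ t, t]` because the time left after a jump is random:
leaving a fast state may use up part of the time, so the induction hypothesis is applied with `δ /
2`. -/
theorem eventually_sub_le [Nontrivial S] (hq : AsymptoticallyRegular q)
    {p : ℝ → ℝ≥0 → S → S → ℝ} (hp : ∀ ε > 0, IsTransitionSemigroup (q ε) (p ε))
    {t : ℝ → ℝ≥0} {E : Set S}
    (hslow : ∀ i ∈ E, Tendsto (fun ε => exitRate q i ε * t ε) (𝓝[>] 0) (𝓝 0))
    (hfast : ∀ i ∉ E, Tendsto (fun ε => exitRate q i ε * t ε) (𝓝[>] 0) atTop)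
    {j : S} (hj : j ∈ E) (n : ℕ) (i : S) {δ : ℝ} (hδ : 0 < δ) {η : ℝ} (hη : 0 < η) :
    ∀ᶠ ε in 𝓝[>] (0 : ℝ), ∀ s : ℝ≥0, δ * t ε ≤ s → s ≤ t ε →
      ∑ m ∈ Finset.range n, (killed (skeleton q) E ^ m) i j - η ≤ p ε s i j := by
  induction n generalizing i δ η with
  | zero =>
    filter_upwards [self_mem_nhdsWithin] with ε hε s _ _
    rw [Finset.sum_range_zero]
    linarith [(hp ε hε).nonneg s i j]
  | succ n ih =>
    set h : S → ℝ := fun k => ∑ m ∈ Finset.range n, (killed (skeleton q) E ^ m) k j with hh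
    have hrec : ∑ m ∈ Finset.range (n + 1), (killed (skeleton q) E ^ m) i j =
        ∑ k, killed (skeleton q) E i k * h k + (1 : Matrix S S ℝ) i j := by
      rw [Finset.sum_range_succ', pow_zero]
      simp only [pow_succ', Matrix.mul_apply, hh, Finset.mul_sum]
      rw [Finset.sum_comm]
    rw [hrec]
    by_cases hi : i ∈ E
    · simp only [killed_of_mem hi, zero_mul, Finset.sum_const_zero, zero_add, Matrix.one_apply]
      split_ifs with hij
      · subst hij
        have h1 : Tendsto (fun ε => Real.exp (-(exitRate q i ε * t ε))) (𝓝[>] 0) (𝓝 1) := by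
          have := (Real.continuous_exp.tendsto _).comp (hslow i hi).neg
          simpa [Function.comp_def] using this
        filter_upwards [h1.eventually_const_lt (by linarith : 1 - η < 1), self_mem_nhdsWithin]
          with ε h2 hε s _ hs
        refine h2.le.trans (le_trans ?_ ((hp ε hε).exp_neg_le (hq.exitRate_pos hε i)
          (fun k hk => (hq.pos ε hε i k hk).le) s))
        rw [Real.exp_le_exp, neg_le_neg_iff]
        exact mul_le_mul_of_nonneg_left hs (hq.exitRate_pos hε i).le
      · filter_upwards [self_mem_nhdsWithin] with ε hε s _ _
        linarith [(hp ε hε).nonneg s i j]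
    · have hij : i ≠ j := fun h => hi (h ▸ hj)
      set M : ℝ → ℝ := fun ε =>
        ∑ k ∈ Finset.univ.erase i, q ε i k / exitRate q i ε * (h k - η / 2) with hM
      have hMlim : Tendsto M (𝓝[>] 0)
          (𝓝 (∑ k ∈ Finset.univ.erase i, skeleton q i k * (h k - η / 2))) :=
        tendsto_finsetSum _ fun k hk =>
          (hq.tendsto_skeleton (Finset.ne_of_mem_erase hk).symm).mul_const _
      have hexp : Tendsto (fun ε => Real.exp (-(δ / 2 * (exitRate q i ε * t ε)))) (𝓝[>] 0)
          (𝓝 0) :=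
        Real.tendsto_exp_neg_atTop_nhds_zero.comp
          ((hfast i hi).const_mul_atTop (half_pos hδ))
      -- The second term bounds the loss from not jumping: there `p ε a i j - M ε ≥ -|M ε|`, with a
      -- factor that vanishes since `i` is fast.
      have hlim := hMlim.sub (hexp.mul hMlim.abs)
      have hval : ∑ k ∈ Finset.univ.erase i, skeleton q i k * (h k - η / 2) =
          ∑ k, killed (skeleton q) E i k * h k - η / 2 := by
        have h1 : ∑ k, killed (skeleton q) E i k * h k =
            ∑ k ∈ Finset.univ.erase i, skeleton q i k * h k := by
          rw [← Finset.add_sum_erase _ _ (Finset.mem_univ i)]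
          simp only [killed_of_notMem hi]
          simp [skeleton]
        rw [h1]
        simp only [mul_sub, Finset.sum_sub_distrib, ← Finset.sum_mul, hq.sum_erase_skeleton,
          one_mul]
      rw [hval, zero_mul, sub_zero] at hlim
      have hij1 : (1 : Matrix S S ℝ) i j = 0 := Matrix.one_apply_ne hij
      rw [hij1, add_zero]
      filter_upwards [hlim.eventually_const_lt
          (by linarith : ∑ k, killed (skeleton q) E i k * h k - η < _),
        eventually_all.2 fun k => ih k (half_pos hδ) (half_pos hη), self_mem_nhdsWithin]
        with ε h1 h2 hε s hs hst
      -- As `s ≥ δ t`, both the window `s - a` for the first jump and the time `a` kept in reserve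
      -- are at least `δ t / 2`.
      set a : ℝ≥0 := (δ / 2 * t ε).toNNReal with ha
      have hacoe : (a : ℝ) = δ / 2 * t ε := Real.coe_toNNReal _ (by positivity)
      have has : a ≤ s := by
        rw [← NNReal.coe_le_coe, hacoe]
        have : 0 ≤ δ * t ε := by positivity
        linarith
      have hlow := (hp ε hε).firstJump_le (j := j) (hq.exitRate_pos hε i)
        (fun k hk => (hq.pos ε hε i k hk).le) has (c := fun k => h k - η / 2)
        (fun u hau hus k _ => h2 k u (by rw [← hacoe]; exact hau) (hus.trans hst))
        (m := M ε) rfl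
      have hle : Real.exp (-(totalRate (q ε) i * (s - a))) ≤
          Real.exp (-(δ / 2 * (exitRate q i ε * t ε))) := by
        rw [Real.exp_le_exp, neg_le_neg_iff]
        have h3 : δ / 2 * t ε ≤ s - a := by rw [hacoe]; linarith
        have h4 := mul_le_mul_of_nonneg_left h3 (hq.exitRate_pos hε i).le
        calc _ = exitRate q i ε * (δ / 2 * t ε) := by ring
          _ ≤ _ := h4
      have h5 := mul_le_mul_of_nonneg_right hle (abs_nonneg (M ε))
      have h6 : -(Real.exp (-(totalRate (q ε) i * (s - a))) * |M ε|) ≤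
          Real.exp (-(totalRate (q ε) i * (s - a))) * (p ε a i j - M ε) := by
        rw [← mul_neg]
        refine mul_le_mul_of_nonneg_left ?_ (Real.exp_pos _).le
        linarith [(hp ε hε).nonneg a i j, le_abs_self (M ε)]
      linarith

/-- If some exit time exceeds the time scale, the chain stops where it first meets a slow state. -/
theorem tendsto_hittingLaw [Nontrivial S] (hq : AsymptoticallyRegular q)
    (hirr : ∀ i j, Accessible (skeleton q) i j)
    {p : ℝ → ℝ≥0 → S → S → ℝ} (hp : ∀ ε > 0, IsTransitionSemigroup (q ε) (p ε))
    {t : ℝ → ℝ≥0} {E : Set S} (hE : E.Nonempty)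
    (hslow : ∀ i ∈ E, Tendsto (fun ε => exitRate q i ε * t ε) (𝓝[>] 0) (𝓝 0))
    (hfast : ∀ i ∉ E, Tendsto (fun ε => exitRate q i ε * t ε) (𝓝[>] 0) atTop) (i j : S) :
    Tendsto (fun ε => p ε (t ε) i j) (𝓝[>] 0) (𝓝 (hittingLaw (skeleton q) E i j)) := by
  refine tendsto_of_eventually_sub_le ?_
    (sum_hittingLaw hq.skeleton_nonneg hq.sum_skeleton hirr hE i) (fun k η hη => ?_) j
  · filter_upwards [self_mem_nhdsWithin] with ε hε using (hp ε hε).sum_eq_one (t ε) i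
  · by_cases hk : k ∈ E
    · obtain ⟨n, hn⟩ := ((hasSum_hittingLaw hq.skeleton_nonneg hq.sum_skeleton i
        hk).tendsto_sum_nat.eventually_const_lt
        (sub_lt_self (hittingLaw (skeleton q) E i k) (half_pos hη))).exists
      filter_upwards [hq.eventually_sub_le hp hslow hfast hk n i one_pos (half_pos hη)]
        with ε hε
      have := hε (t ε) (by simp) le_rfl
      linarith
    · rw [hittingLaw, Set.indicator_of_notMem hk]
      filter_upwards [self_mem_nhdsWithin] with ε hε
      linarith [(hp ε hε).nonneg (t ε) i k]

end AsymptoticallyRegular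

end SlowStates

end

/-! ### Assembly of the two regimes -/

theorem theorem1 {N : ℕ} (hN : 2 ≤ N) (q : ℝ → Fin N → Fin N → ℝ)
    (hq : AsymptoticallyRegular q)
    (h_ergodic : ∃! C : Set (Fin N), IsErgodicClass (skeleton q) C)
    (h_transient : ∀ i, ¬ IsTransientState (skeleton q) i)
    {Ω : ℝ → Type*} [∀ ε, MeasurableSpace (Ω ε)]
    (Pr : ∀ ε, Fin N → Measure (Ω ε)) (X : ∀ ε, ℝ≥0 → Ω ε → Fin N)
    (hX : ∀ ε > 0, IsMarkovChain (q ε) (Pr ε) (X ε))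
    (t : ℝ → ℝ≥0) (ht : ∀ ε > 0, 0 < t ε)
    (h_scale : ∀ i, ((fun ε => (t ε : ℝ)) =o[𝓝[>] 0] inverseRate q i) ∨
      (inverseRate q i =o[𝓝[>] 0] fun ε => (t ε : ℝ))) :
    ∃ ν : Fin N → Fin N → ℝ,
      (∀ i, ν i ∈ stdSimplex ℝ (Fin N)) ∧
      (∀ i j, Tendsto (fun ε => (Pr ε i).real {ω | X ε (t ε) ω = j}) (𝓝[>] 0) (𝓝 (ν i j))) ∧
      (slowStates q t = ∅ →
        ∃ μ : ℝ → Fin N → ℝ,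
          (∀ ε > 0, ∀ m, IsInvariantDistribution (Pr ε) (X ε) m ↔ m = μ ε) ∧
          ∀ i j, Tendsto (fun ε => μ ε j) (𝓝[>] 0) (𝓝 (ν i j))) ∧
      ((slowStates q t).Nonempty →
        ∀ {Ω' : Type*} [MeasurableSpace Ω'] (Pr' : Fin N → Measure Ω') (Z : ℕ → Ω' → Fin N),
          IsDiscreteMarkovChain (skeleton q) Pr' Z →
          ∀ i j, ν i j = (Pr' i).real (hitsAt Z (slowStates q t) j)) := by
  have : Nontrivial (Fin N) := Fin.nontrivial_iff_two_le.2 hN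
  have hirr := accessible_of_existsUnique_ergodicClass h_ergodic h_transient
  have hp : ∀ ε > 0, IsTransitionSemigroup (q ε) fun t i j => (Pr ε i).real {ω | X ε t ω = j} :=
    fun ε hε => (hX ε hε).isTransitionSemigroup
  have hslow : ∀ i ∈ slowStates q t,
      Tendsto (fun ε => exitRate q i ε * t ε) (𝓝[>] 0) (𝓝 0) := fun i hi => by
    refine (IsLittleO.tendsto_div_nhds_zero hi).congr fun ε => ?_
    rw [inverseRate, div_inv_eq_mul, mul_comm]
  have hfast : ∀ i ∉ slowStates q t,
      Tendsto (fun ε => exitRate q i ε * t ε) (𝓝[>] 0) atTop := fun i hi => by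
    have h1 := ((h_scale i).resolve_left hi).tendsto_div_nhds_zero
    -- Positivity makes the approach to `0` one-sided, so that the reciprocal tends to `+∞`.
    have h2 : Tendsto (fun ε => inverseRate q i ε / (t ε : ℝ)) (𝓝[>] 0) (𝓝[>] 0) := by
      refine tendsto_nhdsWithin_iff.2 ⟨h1, ?_⟩
      filter_upwards [self_mem_nhdsWithin] with ε hε
      exact div_pos (inv_pos.2 (hq.exitRate_pos hε i)) (ht ε hε)
    refine h2.inv_tendsto_nhdsGT_zero.congr fun ε => ?_
    rw [Pi.inv_apply, inverseRate, inv_div, div_inv_eq_mul, mul_comm]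
  rcases (slowStates q t).eq_empty_or_nonempty with hE | hE
  · have hbal : ∀ ε, ∃ m : Fin N → ℝ, 0 < ε →
        m ∈ stdSimplex ℝ (Fin N) ∧ IsBalanced (q ε) (totalRate (q ε)) m := fun ε => by
      by_cases hε : 0 < ε
      · obtain ⟨m, hm⟩ := (hp ε hε).exists_isBalanced
        exact ⟨m, fun _ => hm⟩
      · exact ⟨0, fun h => absurd h hε⟩
    choose μ hμ using hbal
    choose L hL using hq.exists_tendsto_balanced hirr (fun ε hε => (hμ ε hε).1)
      fun ε hε => (hμ ε hε).2
    refine ⟨fun _ => L, fun i => ?_, fun i j => ?_, fun _ => ⟨μ, fun ε hε m => ?_, fun _ => hL⟩,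
      fun h => absurd hE h.ne_empty⟩
    · refine (isClosed_stdSimplex ℝ (Fin N)).mem_of_tendsto (tendsto_pi_nhds.2 hL) ?_
      filter_upwards [self_mem_nhdsWithin] with ε hε using (hμ ε hε).1
    · have h1 := (hq.tendsto_sub_balanced hirr hp (fun i => hfast i (hE ▸ Set.notMem_empty i))
        (fun ε hε => (hμ ε hε).1) (fun ε hε => (hμ ε hε).2) i j).add (hL j)
      simpa using h1
    · constructor
      · rintro ⟨hm1, hm2⟩
        -- For fixed `ε` all rates are positive, so irreducibility takes a single step and does not
        -- involve the skeleton.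
        refine (((hp ε hε).isBalanced_iff m).2 hm2).unique (hμ ε hε).2
          (fun i j hij => (hq.pos ε hε i j hij).le) (fun i j => ?_) hm1 (hμ ε hε).1
        rcases eq_or_ne i j with rfl | hij
        · exact .refl
        · exact .single ⟨hij, hq.pos ε hε i j hij⟩
      · rintro rfl
        exact ⟨(hμ ε hε).1, ((hp ε hε).isBalanced_iff _).1 (hμ ε hε).2⟩
  · exact ⟨hittingLaw (skeleton q) (slowStates q t),
      fun i => ⟨hittingLaw_nonneg hq.skeleton_nonneg i,
        sum_hittingLaw hq.skeleton_nonneg hq.sum_skeleton hirr hE i⟩,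
      hq.tendsto_hittingLaw hirr hp hE hslow hfast, fun h => absurd h hE.ne_empty,
      fun _ _ _ _ _ hZ i j =>
        (hZ.measureReal_hitsAt hq.skeleton_nonneg hq.sum_skeleton _ i j).symm⟩
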